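/- For $f\in L^2(\mathbb{R})$ let $\hat f$ be its Fourier transform, normalized so that $f(x)=\int_{\mathbb{R}}e^{ix\xi}\hat f(\xi)\,d\xi$, and let $$e^{it\Delta}f(y)=\int_{\mathbb{R}}e^{iy\xi+it\xi^2}\hat f(\xi)\,d\xi:=\lim_{R\to\infty}\int_{-R}^{R}e^{iy\xi+it\xi^2}\hat f(\xi)\,d\xi$$ wherever this limit exists. Let $H^\sigma(\mathbb{R})$ be the space of $f$ with $(1+|\xi|^2)^{\sigma/2}\hat f\in L^2(\mathbb{R})$. Let $x_0\in\mathbb{R}$, $r>0$, $B(x_0,r)=(x_0-r,x_0+r)$, let $t_0\in\mathbb{R}$, $T>0$ and $I_T(t_0)=[t_0-T,t_0+T]$, where $t_0-T\le 0<t_0+T$. Let $0<\alpha<1$, and let $\gamma$ be a real-valued function such that, for some constants $C$, $C_1>0$, $C_2$, $$|\gamma(x,t)-\gamma(x,t')|\le C|t-t'|^{\alpha},\qquad C_1|x-y|\le|\gamma(x,t)-\gamma(y,t)|\le C_2|x-y|,\qquad \gamma(x,0)=x$$ for all $x,y\in B(x_0,r)$ and $t,t'\in I_T(t_0)$. (1)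 If $1/2\le\alpha<1$, then for every $s>\frac14$, all $\delta,h\ge 0$ with $h\le\delta/2$ and $h<\alpha$, and every $f\in H^{s+\delta}(\mathbb{R})$: for almost every $x\in B(x_0,r)$, $e^{it\Delta}f(\gamma(x,t))$ exists for all sufficiently small $t>0$, and $$e^{it\Delta}f(\gamma(x,t))-f(x)=o(t^h)\quad\text{as } t\to0^+ .$$ (2) If $0<\alpha<1/2$, then the same conclusion holds for every $s>\max\{\frac12-\alpha,\frac14\}$, all $\delta,h\ge0$ with $h\le\alpha\delta$ and $h<\alpha$, and every $f\in H^{s+\delta}(\mathbb{R})$. -/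

import Mathlib

open MeasureTheory Filter Topology Set Asymptotics
open scoped FourierTransform SchwartzMap

noncomputable section

/-- The frequency-truncated Schrödinger evolution
`∫_{|η| ≤ R} e^{2π i y η + i t (2π η)²} 𝓕f(η) dη` of `f ∈ L²(ℝ)`, where `𝓕` is Mathlib's
`L²` Fourier transform, normalized by `𝓕f(η) = ∫ e^{-2π i x η} f(x) dx`. After `ξ = 2π η` this is
the part over `|ξ| ≤ 2π R` of `∫ e^{i y ξ + i t ξ²} f^(ξ) dξ`, with `f^` normalized so that
`f(y) = ∫ e^{i y ξ} f^(ξ) dξ`. -/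
def schrodingerTrunc (f : Lp ℂ 2 (volume : Measure ℝ)) (t y R : ℝ) : ℂ :=
  ∫ η in (-R)..R,
    Complex.exp (Complex.I * (2 * Real.pi * y * η + t * (2 * Real.pi * η) ^ 2 : ℝ)) *
      (𝓕 f : Lp ℂ 2 (volume : Measure ℝ)) η

/-- The oscillatory integral `∫ e^{i y ξ + i t ξ²} f^(ξ) dξ` converges at `(y, t)`, as an improper
integral over `ℝ` (limit of the integrals over symmetric intervals). -/
def SchrodingerConverges (f : Lp ℂ 2 (volume : Measure ℝ)) (t y : ℝ) : Prop :=
  ∃ u : ℂ, Tendsto (schrodingerTrunc f t y) atTop (𝓝 u)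

/-- The pointwise value `e^{itΔ} f (y) = ∫ e^{i y ξ + i t ξ²} f^(ξ) dξ`; it is meaningful at the
points where `SchrodingerConverges f t y` holds. -/
def schrodinger (f : Lp ℂ 2 (volume : Measure ℝ)) (t y : ℝ) : ℂ :=
  limUnder atTop (schrodingerTrunc f t y)

/-- `γ` is a family of curves over `B_r(x₀)` with times in `I_T(t₀) = [t₀ - T, t₀ + T]`: it is
Hölder continuous of order `α` in `t`, bilipschitz in `x`, and satisfies `γ(x, 0) = x`. -/
structure IsBilipHolderCurve (α x₀ r t₀ T : ℝ) (γ : ℝ → ℝ → ℝ) : Prop where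
  holder : ∃ C : ℝ, ∀ x ∈ Metric.ball x₀ r, ∀ t ∈ Icc (t₀ - T) (t₀ + T),
    ∀ t' ∈ Icc (t₀ - T) (t₀ + T), |γ x t - γ x t'| ≤ C * |t - t'| ^ α
  bilipschitz : ∃ C₁ C₂ : ℝ, 0 < C₁ ∧ ∀ x ∈ Metric.ball x₀ r, ∀ y ∈ Metric.ball x₀ r,
    ∀ t ∈ Icc (t₀ - T) (t₀ + T),
      C₁ * |x - y| ≤ |γ x t - γ y t| ∧ |γ x t - γ y t| ≤ C₂ * |x - y|
  initial : ∀ x ∈ Metric.ball x₀ r, γ x 0 = x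

/-- For almost every `x ∈ B_r(x₀)`: `e^{itΔ} f (γ(x,t))` is well defined for all small `t > 0`, and
`e^{itΔ} f (γ(x,t)) - f(x) = o(t^h)` as `t → 0⁺`. -/
def ConvergesAtRate (f : Lp ℂ 2 (volume : Measure ℝ)) (γ : ℝ → ℝ → ℝ) (x₀ r h : ℝ) : Prop :=
  ∀ᵐ x ∂(volume : Measure ℝ), x ∈ Metric.ball x₀ r →
    (∀ᶠ t in 𝓝[>] (0 : ℝ), SchrodingerConverges f t (γ x t)) ∧
    (fun t : ℝ => schrodinger f t (γ x t) - f x) =o[𝓝[>] (0 : ℝ)] (fun t : ℝ => t ^ h)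

end

/-! Cut the frequencies into dyadic blocks N < |η| ≤ 2N. The proof combines a bound on the size of
each block along the curve with a bound on how slowly each block varies near t = 0.

Size. Linearize the maximal function in t and in a frequency cutoff ρ ∈ [N, 2N], and apply TT*. The
kernel at (x, y) is an oscillatory integral over part of the block, with linear coefficient
proportional to γ(x,t) − γ(y,t') and quadratic coefficient proportional to t − t'. By the
bilipschitz and Hölder conditions, either |γ(x,t) − γ(y,t')| ≳ |x − y|, or |t − t'|^α ≳ |x − y|. The
derivative tests then bound the kernel by N^(2σ) (|x − y|^(-1/2) + |x − y|^(-q)) with q = (1 −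
2σ)/(2α), up to a constant (`exists_curve_kernel_bound`). The first alternative needs σ ≥ 1/4;
Schur's test needs q < 1, that is σ > 1/2 − α. These are the two thresholds for s. Summing the
blocks against the Sobolev weight gives, for almost every x, block size at most D(x) N^(-(δ+ε)) with
ε = s − σ > 0 (`ae_exists_forall_le_of_lintegral_le`). This already makes the improper integral
converge for every t in [0, t₀ + T].

Rate. Take m with m ≥ 2, mα ≥ 1 and hm ≤ δ. If t ≥ N^(-m), then t^h ≥ N^(-δ) and the size bound
alone gives a block difference ≲ N^(-ε) t^h. If t ≤ N^(-m), the curve has moved by at most O(1/N)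
and the mean value theorem gains a factor N t^α + N² t ≲ N^δ t^h (`norm_integral_quadExp_sub_le`).
Its derivatives are evaluated on the space-time segment from (x, 0) to (γ(x,t), t), off the curve,
which requires a second maximal estimate, over perturbations of x of size c/N
(`exists_perturbation_maximal_bound`). A fixed block varies by O(t^α + t) = o(t^h), so dominated
convergence for the sum over blocks gives o(t^h) (`exists_tendsto_and_isLittleO_of_dyadic`). The
limit at t = 0 is identified with f(x) by Plancherel along a subsequence of dyadic truncations. -/

/-! ### Derivative tests for quadratic phases -/

/-- The quadratic oscillating exponential `e^{i (A η + τ η²)}`. -/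
noncomputable def quadExp (A τ η : ℝ) : ℂ := Complex.exp (Complex.I * (A * η + τ * η ^ 2 : ℝ))

@[simp]
theorem norm_quadExp (A τ η : ℝ) : ‖quadExp A τ η‖ = 1 := by
  rw [quadExp, mul_comm, Complex.norm_exp_ofReal_mul_I]

@[fun_prop]
theorem continuous_quadExp (A τ : ℝ) : Continuous (quadExp A τ) := by
  unfold quadExp
  fun_prop

theorem hasDerivAt_quadExp (A τ η : ℝ) :
    HasDerivAt (quadExp A τ) (quadExp A τ η * (Complex.I * (A + 2 * τ * η : ℝ))) η := by
  have h : HasDerivAt (fun η : ℝ => A * η + τ * η ^ 2) (A + 2 * τ * η) η := by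
    refine (((hasDerivAt_id' η).const_mul A).add ((hasDerivAt_pow 2 η).const_mul τ)).congr_deriv ?_
    norm_num
    ring
  exact (h.ofReal_comp.const_mul Complex.I).cexp

theorem quadExp_neg (A τ η : ℝ) : quadExp A τ (-η) = quadExp (-A) τ η := by
  simp [quadExp]

/-- First derivative test for a quadratic phase. -/
theorem norm_integral_quadExp_le_div {A τ a b l : ℝ} (hab : a ≤ b) (hl : 0 < l)
    (h : ∀ η ∈ Icc a b, l ≤ |A + 2 * τ * η|) :
    ‖∫ η in a..b, quadExp A τ η‖ ≤ 4 / l := by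
  have hne : ∀ η ∈ Icc a b, A + 2 * τ * η ≠ 0 := fun η hη h0 => by
    have := h η hη
    rw [h0, abs_zero] at this
    linarith
  have hneC : ∀ η ∈ Icc a b, ((A + 2 * τ * η : ℝ) : ℂ) ≠ 0 := fun η hη =>
    Complex.ofReal_ne_zero.2 (hne η hη)
  have hinv : ∀ η ∈ Icc a b, |(A + 2 * τ * η)⁻¹| ≤ 1 / l := fun η hη => by
    rw [abs_inv, ← one_div]
    exact one_div_le_one_div_of_le hl (h η hη)
  have hlin : ∀ η : ℝ, HasDerivAt (fun η : ℝ => A + 2 * τ * η) (2 * τ) η := fun η => by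
    simpa using ((hasDerivAt_id η).const_mul (2 * τ)).const_add A
  have hderinv : ∀ η ∈ Icc a b, HasDerivAt (fun η : ℝ => (A + 2 * τ * η)⁻¹)
      (-(2 * τ) / (A + 2 * τ * η) ^ 2) η := fun η hη => (hlin η).inv (hne η hη)
  have hcont : ContinuousOn (fun η : ℝ => -(2 * τ) / (A + 2 * τ * η) ^ 2) (uIcc a b) := by
    rw [uIcc_of_le hab]
    exact continuousOn_const.div (by fun_prop) fun η hη => pow_ne_zero 2 (hne η hη)
  have hint := (hcont.intervalIntegrable (μ := volume))
  have hintC : IntervalIntegrable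
      (fun η : ℝ => ((-(2 * τ) / (A + 2 * τ * η) ^ 2 : ℝ) : ℂ)) volume a b :=
    (Complex.continuous_ofReal.comp_continuousOn hcont).intervalIntegrable
  have hparts := intervalIntegral.integral_mul_deriv_eq_deriv_mul
    (a := a) (b := b) (u := fun η : ℝ => (((A + 2 * τ * η)⁻¹ : ℝ) : ℂ))
    (u' := fun η : ℝ => ((-(2 * τ) / (A + 2 * τ * η) ^ 2 : ℝ) : ℂ))
    (v := quadExp A τ) (v' := fun η => quadExp A τ η * (Complex.I * (A + 2 * τ * η : ℝ)))
    (fun η hη => (hderinv η (by rwa [uIcc_of_le hab] at hη)).ofReal_comp)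
    (fun η _ => hasDerivAt_quadExp A τ η) hintC
    (Continuous.intervalIntegrable (by fun_prop) _ _)
  have hl1 : ∫ η in a..b, (((A + 2 * τ * η)⁻¹ : ℝ) : ℂ) *
      (quadExp A τ η * (Complex.I * (A + 2 * τ * η : ℝ)))
      = Complex.I * ∫ η in a..b, quadExp A τ η := by
    rw [← intervalIntegral.integral_const_mul]
    refine intervalIntegral.integral_congr fun η hη => ?_
    rw [uIcc_of_le hab] at hη
    have := hneC η hη
    rw [Complex.ofReal_inv]
    field_simp
  -- The derivative of the reciprocal of a linear function has constant sign, so the integral of its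
  -- absolute value is the difference of its endpoint values: no monotonicity assumption on the
  -- phase is needed.
  have hrem : ‖∫ η in a..b, ((-(2 * τ) / (A + 2 * τ * η) ^ 2 : ℝ) : ℂ) * quadExp A τ η‖ ≤
      2 / l := by
    have h1 : ‖∫ η in a..b, ((-(2 * τ) / (A + 2 * τ * η) ^ 2 : ℝ) : ℂ) * quadExp A τ η‖ ≤
        |∫ η in a..b, -(2 * τ) / (A + 2 * τ * η) ^ 2| := by
      refine (intervalIntegral.norm_integral_le_integral_norm hab).trans ?_
      simp only [norm_mul, norm_quadExp, mul_one, Complex.norm_real, Real.norm_eq_abs]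
      rcases le_total 0 (-(2 * τ)) with hτ | hτ
      · rw [abs_of_nonneg (intervalIntegral.integral_nonneg hab fun η _ => by positivity)]
        refine le_of_eq (intervalIntegral.integral_congr fun η _ => ?_)
        exact abs_of_nonneg (by positivity)
      · rw [← abs_neg, ← intervalIntegral.integral_neg]
        refine le_trans (le_of_eq (intervalIntegral.integral_congr fun η _ => ?_)) (le_abs_self _)
        exact abs_of_nonpos (div_nonpos_of_nonpos_of_nonneg hτ (by positivity))
    refine h1.trans ?_
    rw [intervalIntegral.integral_eq_sub_of_hasDerivAt
      (fun η hη => hderinv η (by rwa [uIcc_of_le hab] at hη)) hint]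
    refine (abs_sub _ _).trans ?_
    have := hinv a (left_mem_Icc.2 hab)
    have := hinv b (right_mem_Icc.2 hab)
    have h2 : 2 / l = 1 / l + 1 / l := by ring
    linarith
  rw [hl1] at hparts
  have hn := congrArg norm hparts
  rw [norm_mul, Complex.norm_I, one_mul] at hn
  rw [hn]
  refine (norm_sub_le _ _).trans ?_
  have h3 := norm_sub_le ((((A + 2 * τ * b)⁻¹ : ℝ) : ℂ) * quadExp A τ b)
    ((((A + 2 * τ * a)⁻¹ : ℝ) : ℂ) * quadExp A τ a)
  simp only [norm_mul, norm_quadExp, mul_one, Complex.norm_real, Real.norm_eq_abs] at h3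
  have := hinv a (left_mem_Icc.2 hab)
  have := hinv b (right_mem_Icc.2 hab)
  have h4 : 4 / l = 1 / l + 1 / l + 2 / l := by ring
  linarith

/-- Second derivative test for a quadratic phase. -/
theorem norm_integral_quadExp_le_sqrt {A τ a b : ℝ} (hab : a ≤ b) (hτ : τ ≠ 0) :
    ‖∫ η in a..b, quadExp A τ η‖ ≤ 6 / √|τ| := by
  have hs : 0 < √|τ| := Real.sqrt_pos.2 (abs_pos.2 hτ)
  have hss : √|τ| * √|τ| = |τ| := Real.mul_self_sqrt (abs_nonneg _)
  -- The critical point u is cut out by a window of radius m. The window has length 2m, and outside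
  -- it the derivative is at least 2√|τ|, so each tail is also at most 4 / (2√|τ|) = 2m.
  set u := -A / (2 * τ) with hu
  set m := 1 / √|τ| with hm
  have hm0 : 0 < m := by positivity
  have hder : ∀ η : ℝ, |A + 2 * τ * η| = 2 * |τ| * |η - u| := fun η => by
    have : A + 2 * τ * η = 2 * τ * (η - u) := by
      rw [hu]; field_simp; ring
    rw [this, abs_mul, abs_mul, abs_two]
  have hlow : ∀ η : ℝ, m ≤ |η - u| → 2 * √|τ| ≤ |A + 2 * τ * η| := fun η h => by
    rw [hder]
    have : |τ| * m = √|τ| := by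
      rw [hm, mul_one_div, div_eq_iff hs.ne', hss]
    nlinarith [mul_le_mul_of_nonneg_left h (abs_nonneg τ)]
  have hquarter : 4 / (2 * √|τ|) = 2 * m := by rw [hm]; field_simp; norm_num
  -- Clamping the window to [a, b] covers every position of u, including windows that miss the
  -- interval.
  set p := max a (min b (u - m)) with hp
  set q := max a (min b (u + m)) with hq
  have hap : a ≤ p := le_max_left _ _
  have hpq : p ≤ q := max_le_max le_rfl (min_le_min le_rfl (by linarith))
  have hqb : q ≤ b := max_le hab (min_le_left _ _)
  have h1 : ‖∫ η in a..p, quadExp A τ η‖ ≤ 2 * m := by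
    rcases le_total (u - m) a with h | h
    · have : p = a := max_eq_left ((min_le_right _ _).trans h)
      rw [this]; simp; positivity
    · rw [← hquarter]
      refine norm_integral_quadExp_le_div hap (by positivity) fun η hη => hlow η ?_
      have : η ≤ u - m := hη.2.trans (max_le h (min_le_right _ _))
      rw [abs_sub_comm]
      exact le_trans (by linarith) (le_abs_self _)
  have h3 : ‖∫ η in q..b, quadExp A τ η‖ ≤ 2 * m := by
    rcases le_total b (u + m) with h | h
    · have : q = b := by rw [hq, min_eq_left h, max_eq_right hab]
      rw [this]; simp; positivity
    · rw [← hquarter]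
      refine norm_integral_quadExp_le_div hqb (by positivity) fun η hη => hlow η ?_
      have : u + m ≤ η := le_trans (by rw [hq, min_eq_right h]; exact le_max_right _ _) hη.1
      exact le_trans (by linarith) (le_abs_self _)
  have h2 : ‖∫ η in p..q, quadExp A τ η‖ ≤ 2 * m := by
    refine (intervalIntegral.norm_integral_le_of_norm_le_const (C := 1) fun η _ => by simp).trans ?_
    rw [one_mul, abs_of_nonneg (by linarith)]
    have : q ≤ p + 2 * m := by
      refine max_le (by linarith) ?_
      rcases le_total b (u - m) with h | h
      · exact (min_le_left _ _).trans
          (by rw [hp, min_eq_left h, max_eq_right hab]; linarith)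
      · have : u - m ≤ p := by rw [hp, min_eq_right h]; exact le_max_right _ _
        exact (min_le_right _ _).trans (by linarith)
    linarith
  have hi : ∀ x y : ℝ, IntervalIntegrable (quadExp A τ) volume x y := fun x y =>
    (continuous_quadExp A τ).intervalIntegrable _ _
  rw [← intervalIntegral.integral_add_adjacent_intervals (hi a p) (hi p b),
    ← intervalIntegral.integral_add_adjacent_intervals (hi p q) (hi q b)]
  refine (norm_add_le _ _).trans ?_
  have := norm_add_le (∫ η in p..q, quadExp A τ η) (∫ η in q..b, quadExp A τ η)
  have h6 : 6 / √|τ| = 6 * m := by rw [hm]; ring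
  linarith

/-! ### Oscillatory integrals over dyadic annuli -/

/-- The frequency annulus `N < |η| ≤ M`. -/
def freqAnnulus (N M : ℝ) : Set ℝ := {η | N < |η| ∧ |η| ≤ M}

theorem measurableSet_freqAnnulus (N M : ℝ) : MeasurableSet (freqAnnulus N M) :=
  (measurableSet_lt measurable_const measurable_norm).inter
    (measurableSet_le measurable_norm measurable_const)

theorem freqAnnulus_eq_empty {N M : ℝ} (h : M ≤ N) : freqAnnulus N M = ∅ :=
  eq_empty_of_forall_notMem fun _ hη => absurd (hη.1.trans_le hη.2) (not_lt.2 h)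

theorem freqAnnulus_eq_union {N M : ℝ} (hN : 0 < N) :
    freqAnnulus N M = Ioc N M ∪ Ico (-M) (-N) := by
  ext η
  simp only [freqAnnulus, mem_ofPred_eq, mem_union, mem_Ioc, mem_Ico]
  rcases le_total 0 η with h | h
  · rw [abs_of_nonneg h]
    exact ⟨Or.inl, fun h' => h'.elim id fun h' => by linarith [h'.2]⟩
  · rw [abs_of_nonpos h]
    exact ⟨fun h' => Or.inr ⟨by linarith, by linarith⟩, fun h' => h'.elim
      (fun h' => by linarith [h'.1]) fun h' => ⟨by linarith [h'.2], by linarith [h'.1]⟩⟩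

theorem setIntegral_freqAnnulus_quadExp {N M : ℝ} (hN : 0 < N) (hM : N ≤ M) (A τ : ℝ) :
    ∫ η in freqAnnulus N M, quadExp A τ η =
      (∫ η in N..M, quadExp A τ η) + ∫ η in N..M, quadExp (-A) τ η := by
  have hi : ∀ B x y, IntegrableOn (quadExp B τ) (Icc x y) := fun B x y =>
    (continuous_quadExp B τ).continuousOn.integrableOn_Icc
  rw [freqAnnulus_eq_union hN, setIntegral_union _ measurableSet_Ico
    ((hi A N M).mono_set Ioc_subset_Icc_self) ((hi A (-M) (-N)).mono_set Ico_subset_Icc_self)]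
  · rw [intervalIntegral.integral_of_le hM, integral_Ico_eq_integral_Ioc,
      ← intervalIntegral.integral_of_le (by linarith : -M ≤ -N)]
    congr 1
    rw [← intervalIntegral.integral_comp_neg]
    simp [quadExp_neg]
  · rw [disjoint_left]
    intro η h1 h2
    linarith [h1.1, h2.2]

theorem norm_setIntegral_freqAnnulus_le {N M : ℝ} (hN : 0 < N) (hM : M ≤ 2 * N) (A τ : ℝ) :
    ‖∫ η in freqAnnulus N M, quadExp A τ η‖ ≤ 2 * N := by
  rcases le_total M N with h | h
  · rw [freqAnnulus_eq_empty h]; simp; linarith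
  rw [setIntegral_freqAnnulus_quadExp hN h]
  have : ∀ B, ‖∫ η in N..M, quadExp B τ η‖ ≤ N := fun B => by
    refine (intervalIntegral.norm_integral_le_of_norm_le_const (C := 1) fun η _ => by simp).trans ?_
    rw [one_mul, abs_of_nonneg (by linarith)]
    linarith
  refine (norm_add_le _ _).trans ?_
  linarith [this A, this (-A)]

theorem norm_setIntegral_freqAnnulus_le_sqrt {N M : ℝ} (hN : 0 < N) (A : ℝ) {τ : ℝ}
    (hτ : τ ≠ 0) : ‖∫ η in freqAnnulus N M, quadExp A τ η‖ ≤ 12 / √|τ| := by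
  rcases le_total M N with h | h
  · rw [freqAnnulus_eq_empty h]; simp; positivity
  rw [setIntegral_freqAnnulus_quadExp hN h]
  refine (norm_add_le _ _).trans ?_
  have h1 := norm_integral_quadExp_le_sqrt (A := A) h hτ
  have h2 := norm_integral_quadExp_le_sqrt (A := -A) h hτ
  have h3 : 12 / √|τ| = 6 / √|τ| + 6 / √|τ| := by ring
  linarith

/-- A bound for the oscillatory integral over a dyadic annulus in terms of the linear part of the
phase alone. -/
theorem norm_setIntegral_freqAnnulus_le_sqrt_div {N M : ℝ} (hN : 0 < N) (hM : M ≤ 2 * N) {A : ℝ}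
    (hA : A ≠ 0) (τ : ℝ) :
    ‖∫ η in freqAnnulus N M, quadExp A τ η‖ ≤ 34 * √(N / |A|) := by
  have hA' : 0 < |A| := abs_pos.2 hA
  rcases le_total M N with h | h
  · rw [freqAnnulus_eq_empty h, setIntegral_empty, norm_zero]
    positivity
  -- If the linear part dominates, the derivative is at least |A|/2, and the geometric mean of the
  -- bounds 2N and 16/|A| is taken. Otherwise |τ| ≥ |A|/(8N) and the second derivative test
  -- suffices; here 12√8 ≤ 34.
  rcases le_total (8 * |τ| * N) |A| with hc | hc
  · have key : ∀ B, |B| = |A| → ‖∫ η in N..M, quadExp B τ η‖ ≤ 4 / (|A| / 2) := fun B hB => by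
      refine norm_integral_quadExp_le_div h (by positivity) fun η hη => ?_
      have h1 : |B| - |2 * τ * η| ≤ |B + 2 * τ * η| := by
        have := abs_sub_abs_le_abs_sub B (-(2 * τ * η))
        simpa using this
      have h2 : |2 * τ * η| ≤ 4 * |τ| * N := by
        rw [abs_mul, abs_mul, abs_two, abs_of_nonneg (hN.le.trans hη.1)]
        nlinarith [mul_le_mul_of_nonneg_left (hη.2.trans hM) (abs_nonneg τ)]
      linarith
    have hb : ‖∫ η in freqAnnulus N M, quadExp A τ η‖ ≤ 16 / |A| := by
      rw [setIntegral_freqAnnulus_quadExp hN h]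
      refine (norm_add_le _ _).trans ?_
      have h1 := key A rfl
      have h2 := key (-A) (abs_neg A)
      have h3 : 16 / |A| = 4 / (|A| / 2) + 4 / (|A| / 2) := by field_simp; norm_num
      linarith
    have hb' := norm_setIntegral_freqAnnulus_le hN hM A τ
    set K := ‖∫ η in freqAnnulus N M, quadExp A τ η‖
    have hK : 0 ≤ K := norm_nonneg _
    have : K ^ 2 ≤ 32 * (N / |A|) := by
      calc K ^ 2 = K * K := sq K
        _ ≤ (2 * N) * (16 / |A|) := mul_le_mul hb' hb hK (by positivity)
        _ = _ := by ring
    have h2 : K ≤ √(34 ^ 2 * (N / |A|)) := Real.le_sqrt_of_sq_le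
      (this.trans (mul_le_mul_of_nonneg_right (by norm_num) (by positivity)))
    rwa [Real.sqrt_mul (by norm_num), Real.sqrt_sq (by norm_num)] at h2
  · have hτ : τ ≠ 0 := fun h0 => by
      rw [h0] at hc; simp at hc; exact hA hc
    have hτ' : 0 < |τ| := abs_pos.2 hτ
    refine (norm_setIntegral_freqAnnulus_le_sqrt hN A hτ).trans ?_
    rw [show (34 : ℝ) * √(N / |A|) = √(34 ^ 2 * (N / |A|)) by
      rw [Real.sqrt_mul (by norm_num), Real.sqrt_sq (by norm_num)]]
    refine Real.le_sqrt_of_sq_le ?_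
    rw [div_pow, Real.sq_sqrt hτ'.le, mul_div_assoc', div_le_div_iff₀ hτ' hA']
    nlinarith

/-! ### The TT* method for linear and maximal operators -/

section TTStar

open scoped ENNReal ComplexConjugate

variable {X Y : Type*} [MeasurableSpace X] [MeasurableSpace Y]

/-- Schur's test in quadratic form: v(x)v(y) ≤ v(x)² + v(y)², and symmetry makes the two resulting
terms equal. The cruder inequality without the factor 1/2 accounts for the constant 2. -/
theorem lintegral_lintegral_mul_le_of_symm {μ : Measure X} [SFinite μ] {k : X → X → ℝ≥0∞}
    (hk : Measurable (Function.uncurry k)) (hsymm : ∀ x y, k x y = k y x) {A : ℝ≥0∞}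
    (hA : ∀ x, ∫⁻ y, k x y ∂μ ≤ A) {v : X → ℝ≥0∞} (hv : Measurable v) :
    ∫⁻ x, ∫⁻ y, v x * (v y * k x y) ∂μ ∂μ ≤ 2 * A * ∫⁻ x, v x ^ 2 ∂μ := by
  have h1 : ∀ x y, v x * (v y * k x y) ≤ v x ^ 2 * k x y + v y ^ 2 * k x y := fun x y => by
    rw [← mul_assoc, ← add_mul]
    gcongr
    rcases le_total (v x) (v y) with h | h
    · exact (mul_le_mul_left h _).trans (by rw [sq (v y)]; exact le_add_self)
    · exact (mul_le_mul_right h _).trans (by rw [sq (v x)]; exact le_self_add)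
  have hm1 : Measurable fun p : X × X => v p.1 ^ 2 * k p.1 p.2 := by
    have := hk; fun_prop
  have hm2 : Measurable fun p : X × X => v p.2 ^ 2 * k p.1 p.2 := by
    have := hk; fun_prop
  have hB : ∫⁻ x, ∫⁻ y, v x ^ 2 * k x y ∂μ ∂μ ≤ A * ∫⁻ x, v x ^ 2 ∂μ := by
    rw [← lintegral_const_mul _ (by fun_prop)]
    refine lintegral_mono fun x => ?_
    rw [lintegral_const_mul _ (by exact hk.of_uncurry_left), mul_comm]
    exact mul_le_mul_left (hA x) _
  calc ∫⁻ x, ∫⁻ y, v x * (v y * k x y) ∂μ ∂μ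
      ≤ ∫⁻ x, ∫⁻ y, (v x ^ 2 * k x y + v y ^ 2 * k x y) ∂μ ∂μ :=
        lintegral_mono fun x => lintegral_mono fun y => h1 x y
    _ = ∫⁻ x, ((∫⁻ y, v x ^ 2 * k x y ∂μ) + ∫⁻ y, v y ^ 2 * k x y ∂μ) ∂μ :=
        lintegral_congr fun x => lintegral_add_left (hm1.comp (by fun_prop : Measurable fun y => (x, y))) _
    _ = (∫⁻ x, ∫⁻ y, v x ^ 2 * k x y ∂μ ∂μ) + ∫⁻ x, ∫⁻ y, v y ^ 2 * k x y ∂μ ∂μ :=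
        lintegral_add_left hm1.lintegral_prod_right' _
    _ = (∫⁻ x, ∫⁻ y, v x ^ 2 * k x y ∂μ ∂μ) + ∫⁻ x, ∫⁻ y, v x ^ 2 * k x y ∂μ ∂μ := by
        congr 1
        rw [lintegral_lintegral_swap hm2.aemeasurable]
        simp_rw [hsymm]
    _ ≤ A * (∫⁻ x, v x ^ 2 ∂μ) + A * ∫⁻ x, v x ^ 2 ∂μ := add_le_add hB hB
    _ = _ := by ring

/-- Passes to a complex integral, where Fubini with signs can be used; it also shows that the left
side is finite. -/
theorem lintegral_enorm_sq_eq_enorm_integral {μ : Measure X} [IsFiniteMeasure μ] {f : X → ℂ}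
    (hf : AEStronglyMeasurable f μ) {C : ℝ} (hC : ∀ x, ‖f x‖ ≤ C) :
    ∫⁻ x, ‖f x‖ₑ ^ 2 ∂μ = ‖∫ x, f x * conj (f x) ∂μ‖ₑ := by
  have h1 : ∫ x, f x * conj (f x) ∂μ = ((∫ x, ‖f x‖ ^ 2 ∂μ : ℝ) : ℂ) := by
    rw [← integral_complex_ofReal]
    refine integral_congr_ae (Eventually.of_forall fun x => ?_)
    simp only [Complex.mul_conj, Complex.normSq_eq_norm_sq]
  have hi : Integrable (fun x => ‖f x‖ ^ 2) μ :=
    Integrable.of_bound (hf.norm.pow 2) (C ^ 2) (Eventually.of_forall fun x => by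
      rw [norm_pow, norm_norm]; exact pow_le_pow_left₀ (norm_nonneg _) (hC x) 2)
  have hnn : 0 ≤ ∫ x, ‖f x‖ ^ 2 ∂μ := integral_nonneg fun x => by positivity
  rw [h1, ← ofReal_norm, Complex.norm_real, Real.norm_of_nonneg hnn,
    ofReal_integral_eq_lintegral_ofReal hi (Eventually.of_forall fun x => by positivity)]
  refine lintegral_congr fun x => ?_
  rw [ENNReal.ofReal_pow (norm_nonneg _), ofReal_norm]

/-- The `TT*` method with Schur's test: an operator with bounded kernel `E` is bounded on `L²` as
soon as the kernel of `TT*` is dominated by a symmetric kernel with bounded marginals. -/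
theorem lintegral_enorm_sq_le_of_kernel {μ : Measure X} {ν : Measure Y} [IsFiniteMeasure μ]
    [IsFiniteMeasure ν] {E : X → Y → ℂ} (hE : Measurable (Function.uncurry E))
    (hE1 : ∀ x η, ‖E x η‖ ≤ 1) {k : X → X → ℝ≥0∞} (hk : Measurable (Function.uncurry k))
    (hsymm : ∀ x y, k x y = k y x) {A : ℝ≥0∞} (hA : ∀ x, ∫⁻ y, k x y ∂μ ≤ A)
    (hK : ∀ x, ∀ᵐ y ∂μ, ‖∫ η, E x η * conj (E y η) ∂ν‖ₑ ≤ k x y)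
    {g : Y → ℂ} (hg : MemLp g 2 ν) :
    ∫⁻ x, ‖∫ η, E x η * g η ∂ν‖ₑ ^ 2 ∂μ ≤ 2 * A * ∫⁻ η, ‖g η‖ₑ ^ 2 ∂ν := by
  wlog hgm : Measurable g generalizing g
  · have hae := hg.1.ae_eq_mk
    have := this ((memLp_congr_ae hae).1 hg) hg.1.stronglyMeasurable_mk.measurable
    rw [lintegral_congr_ae (hae.mono fun η h => by rw [h])]
    refine le_trans (le_of_eq (lintegral_congr fun x => ?_)) this
    rw [integral_congr_ae (hae.mono fun η h => by rw [h])]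
  have hgi : Integrable g ν := hg.integrable (by norm_num)
  set T : X → ℂ := fun x => ∫ η, E x η * g η ∂ν with hT
  have hTm : Measurable T := by
    refine (StronglyMeasurable.integral_prod_right (f := fun x η => E x η * g η) ?_).measurable
    exact (hE.mul (hgm.comp measurable_snd)).stronglyMeasurable
  set B := ∫ η, ‖g η‖ ∂ν with hB
  have hTB : ∀ x, ‖T x‖ ≤ B := fun x =>
    norm_integral_le_of_norm_le hgi.norm (Eventually.of_forall fun η => by
      rw [norm_mul]; exact mul_le_of_le_one_left (norm_nonneg _) (hE1 x η))
  set w : X → ℂ := fun x => conj (T x) with hw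
  have hwm : Measurable w := by fun_prop
  have hwB : ∀ x, ‖w x‖ ≤ B := fun x => by rw [hw]; simpa using hTB x
  have hB0 : 0 ≤ B := integral_nonneg fun η => norm_nonneg _
  set V : Y → ℂ := fun η => ∫ x, w x * E x η ∂μ with hV
  have hwE : Measurable fun p : X × Y => w p.1 * E p.1 p.2 := (hwm.comp measurable_fst).mul hE
  have hVm : Measurable V := by
    refine (StronglyMeasurable.integral_prod_right (f := fun η x => w x * E x η) ?_).measurable
    exact (hwE.comp measurable_swap).stronglyMeasurable
  have hwEB : ∀ x η, ‖w x * E x η‖ ≤ B := fun x η => by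
    rw [norm_mul]
    exact (mul_le_of_le_one_right (norm_nonneg _) (hE1 x η)).trans (hwB x)
  have hVB : ∀ η, ‖V η‖ ≤ B * μ.real univ := fun η =>
    norm_integral_le_of_norm_le_const (Eventually.of_forall fun x => hwEB x η)
  set Q := ∫⁻ x, ‖T x‖ₑ ^ 2 ∂μ with hQ
  have hwQ : ∫⁻ x, ‖w x‖ₑ ^ 2 ∂μ = Q := lintegral_congr fun x => by simp [hw]
  have hQfin : Q ≠ ∞ := by
    rw [hQ, lintegral_enorm_sq_eq_enorm_integral hTm.aestronglyMeasurable hTB]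
    exact enorm_ne_top
  -- Duality: ‖Tg‖² is the pairing of V, the transpose of T applied to the conjugate of Tg, with g;
  -- then Cauchy–Schwarz.
  have hQV : Q ≤ (∫⁻ η, ‖V η‖ₑ ^ 2 ∂ν) ^ (1 / 2 : ℝ) * (∫⁻ η, ‖g η‖ₑ ^ 2 ∂ν) ^ (1 / 2 : ℝ) := by
    have h1 : ∫ x, T x * conj (T x) ∂μ = ∫ η, V η * g η ∂ν := by
      have hint : Integrable (Function.uncurry fun x η => w x * E x η * g η) (μ.prod ν) :=
        (hgi.comp_snd μ).bdd_mul hwE.aestronglyMeasurable (c := B)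
          (Eventually.of_forall fun p => hwEB p.1 p.2)
      calc ∫ x, T x * conj (T x) ∂μ = ∫ x, ∫ η, w x * E x η * g η ∂ν ∂μ := by
            refine integral_congr_ae (Eventually.of_forall fun x => ?_)
            simp only [mul_assoc, integral_const_mul]
            exact mul_comm _ _
        _ = ∫ η, ∫ x, w x * E x η * g η ∂μ ∂ν := integral_integral_swap hint
        _ = _ := by simp only [integral_mul_const, hV]
    rw [hQ, lintegral_enorm_sq_eq_enorm_integral hTm.aestronglyMeasurable hTB, h1]
    refine (enorm_integral_le_lintegral_enorm _).trans ?_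
    simp_rw [enorm_mul]
    have := ENNReal.lintegral_mul_le_Lp_mul_Lq ν Real.HolderConjugate.two_two
      hVm.enorm.aemeasurable hgm.enorm.aemeasurable
    simpa using this
  -- Expanding the square of V produces exactly the kernel of TT*, to which Schur's test applies.
  have hVQ : ∫⁻ η, ‖V η‖ₑ ^ 2 ∂ν ≤ 2 * A * Q := by
    have h1 : ∫ η, V η * conj (V η) ∂ν =
        ∫ x, w x * ∫ y, conj (w y) * ∫ η, E x η * conj (E y η) ∂ν ∂μ ∂μ := by
      have hint : Integrable (Function.uncurry fun η x => w x * E x η * conj (V η))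
          (ν.prod μ) := by
        refine Integrable.of_bound (C := B * (B * μ.real univ)) ?_ (Eventually.of_forall fun p => ?_)
        · exact ((hwE.comp measurable_swap).mul (by fun_prop)).aestronglyMeasurable
        · simp only [Function.uncurry, norm_mul (_ * _), RCLike.norm_conj]
          exact mul_le_mul (hwEB _ _) (hVB _) (norm_nonneg _) hB0
      calc ∫ η, V η * conj (V η) ∂ν = ∫ η, ∫ x, w x * E x η * conj (V η) ∂μ ∂ν := by
            simp only [integral_mul_const, hV]
        _ = ∫ x, ∫ η, w x * E x η * conj (V η) ∂ν ∂μ := integral_integral_swap hint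
        _ = _ := by
          refine integral_congr_ae (Eventually.of_forall fun x => ?_)
          simp only [mul_assoc, integral_const_mul]
          congr 1
          have hint2 : Integrable (Function.uncurry fun η y => conj (w y * E y η) * E x η)
              (ν.prod μ) := by
            refine Integrable.of_bound (C := B * 1) ?_ (Eventually.of_forall fun p => ?_)
            · refine (Measurable.mul ?_ ?_).aestronglyMeasurable
              · exact Complex.continuous_conj.measurable.comp (hwE.comp measurable_swap)
              · exact (hE.comp (measurable_const.prodMk measurable_fst) :)
            · simp only [Function.uncurry]
              rw [norm_mul, RCLike.norm_conj]
              exact mul_le_mul (hwEB _ _) (hE1 _ _) (norm_nonneg _) hB0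
          calc ∫ η, E x η * conj (V η) ∂ν = ∫ η, ∫ y, conj (w y * E y η) * E x η ∂μ ∂ν := by
                refine integral_congr_ae (Eventually.of_forall fun η => ?_)
                simp only [integral_mul_const, integral_conj, hV]
                exact mul_comm _ _
            _ = ∫ y, ∫ η, conj (w y * E y η) * E x η ∂ν ∂μ := integral_integral_swap hint2
            _ = _ := by
                refine integral_congr_ae (Eventually.of_forall fun y => ?_)
                simp only [← integral_const_mul, map_mul]
                refine integral_congr_ae (Eventually.of_forall fun η => ?_)
                simp only
                ring
    rw [lintegral_enorm_sq_eq_enorm_integral hVm.aestronglyMeasurable hVB, h1, ← hwQ]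
    refine (enorm_integral_le_lintegral_enorm _).trans ?_
    refine le_trans (lintegral_mono fun x => ?_)
      (lintegral_lintegral_mul_le_of_symm hk hsymm hA hwm.enorm)
    rw [enorm_mul, lintegral_const_mul' _ _ enorm_ne_top]
    refine mul_le_mul_right ((enorm_integral_le_lintegral_enorm _).trans ?_) _
    refine lintegral_mono_ae ((hK x).mono fun y hy => ?_)
    rw [enorm_mul, RCLike.enorm_conj]
    exact mul_le_mul_right hy _
  set G := ∫⁻ η, ‖g η‖ₑ ^ 2 ∂ν
  rcases eq_or_ne Q 0 with hQ0 | hQ0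
  · rw [hQ0]; exact zero_le
  -- One factor Q can be cancelled because Q is finite, which is where the boundedness of E and the
  -- finiteness of the measures enter.
  have hsq : Q * Q ≤ Q * (2 * A * G) := by
    have h1 : Q ^ (2 : ℝ) ≤ ((2 * A * Q) ^ (1 / 2 : ℝ) * G ^ (1 / 2 : ℝ)) ^ (2 : ℝ) :=
      ENNReal.rpow_le_rpow (hQV.trans (mul_le_mul_left
        (ENNReal.rpow_le_rpow hVQ (by norm_num)) _)) (by norm_num)
    rw [← ENNReal.mul_rpow_of_nonneg _ _ (by norm_num), ← ENNReal.rpow_mul] at h1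
    norm_num at h1
    calc Q * Q = Q ^ 2 := (sq Q).symm
      _ ≤ _ := h1
      _ = _ := by ring
  exact (ENNReal.mul_le_mul_iff_right hQ0 hQfin).1 hsq

/-- Measurable selection of the index attaining a finite maximum; it turns the maximal operator into
a linear one. -/
theorem exists_measurable_argmax {u : ℕ → X → ℝ≥0∞} (hu : ∀ n, Measurable (u n)) (n : ℕ) :
    ∃ j : X → ℕ, Measurable j ∧ ∀ x, ∀ i ≤ n, u i x ≤ u (j x) x := by
  induction n with
  | zero => exact ⟨fun _ => 0, measurable_const, fun x i hi => by rw [Nat.le_zero.1 hi]⟩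
  | succ n ih =>
    obtain ⟨j, hj, hmax⟩ := ih
    have hm : Measurable fun x => u (j x) x := by
      have : Measurable (Function.uncurry u) := measurable_from_prod_countable_right hu
      exact this.comp (hj.prodMk measurable_id)
    refine ⟨fun x => if u (j x) x ≤ u (n + 1) x then n + 1 else j x,
      Measurable.ite (measurableSet_le hm (hu _)) measurable_const hj, fun x i hi => ?_⟩
    by_cases h : u (j x) x ≤ u (n + 1) x
    · simp only [if_pos h]
      rcases Nat.le_succ_iff.1 hi with hi | rfl
      · exact (hmax x i hi).trans h
      · exact le_rfl
    · simp only [if_neg h]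
      rcases Nat.le_succ_iff.1 hi with hi | rfl
      · exact hmax x i hi
      · exact (not_le.1 h).le

/-- Continuity reduces an uncountable supremum to a countable one, which restores measurability. -/
theorem iSup_denseSeq_eq {P : Type*} [TopologicalSpace P] [TopologicalSpace.SeparableSpace P]
    [Nonempty P] {c : P → ℝ≥0∞} (hc : Continuous c) :
    ⨆ p, c p = ⨆ n, c (TopologicalSpace.denseSeq P n) := by
  refine le_antisymm (iSup_le fun p => ?_) (iSup_le fun n => le_iSup c _)
  have hcl : IsClosed {p | c p ≤ ⨆ n, c (TopologicalSpace.denseSeq P n)} :=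
    isClosed_le hc continuous_const
  exact (TopologicalSpace.denseRange_denseSeq P).induction_on p hcl
    fun n => le_iSup (fun n => c (TopologicalSpace.denseSeq P n)) n

/-- The linearized `TT*` method for a maximal function over a separable parameter space. -/
theorem lintegral_iSup_enorm_sq_le_of_kernel {P : Type*} [TopologicalSpace P]
    [TopologicalSpace.SeparableSpace P] [Nonempty P]
    {μ : Measure X} {ν : Measure Y} [IsFiniteMeasure μ]
    [IsFiniteMeasure ν] {E : P → X → Y → ℂ} (hE : ∀ p, Measurable (Function.uncurry (E p)))
    (hE1 : ∀ p x η, ‖E p x η‖ ≤ 1) {k : X → X → ℝ≥0∞} (hk : Measurable (Function.uncurry k))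
    (hsymm : ∀ x y, k x y = k y x) {A : ℝ≥0∞} (hA : ∀ x, ∫⁻ y, k x y ∂μ ≤ A)
    (hK : ∀ x, ∀ᵐ y ∂μ, ∀ p p', ‖∫ η, E p x η * conj (E p' y η) ∂ν‖ₑ ≤ k x y)
    {g : Y → ℂ} (hg : MemLp g 2 ν)
    (hcont : ∀ x, Continuous fun p => ∫ η, E p x η * g η ∂ν) :
    AEMeasurable (fun x => ⨆ p, ‖∫ η, E p x η * g η ∂ν‖ₑ ^ 2) μ ∧
    ∫⁻ x, ⨆ p, ‖∫ η, E p x η * g η ∂ν‖ₑ ^ 2 ∂μ ≤ 2 * A * ∫⁻ η, ‖g η‖ₑ ^ 2 ∂ν := by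
  wlog hgm : Measurable g generalizing g
  · have hae := hg.1.ae_eq_mk
    have heq : ∀ p x, ∫ η, E p x η * g η ∂ν = ∫ η, E p x η * hg.1.mk g η ∂ν := fun p x =>
      integral_congr_ae (hae.mono fun η h => congrArg (E p x η * ·) h)
    have := this ((memLp_congr_ae hae).1 hg) (by simpa only [heq] using hcont)
      hg.1.stronglyMeasurable_mk.measurable
    rw [lintegral_congr_ae (hae.mono fun η h => by rw [h])]
    simpa only [heq] using this
  set e := TopologicalSpace.denseSeq P
  set u : ℕ → X → ℝ≥0∞ := fun n x => ‖∫ η, E (e n) x η * g η ∂ν‖ₑ ^ 2 with hu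
  have hum : ∀ n, Measurable (u n) := fun n => by
    have : Measurable fun x => ∫ η, E (e n) x η * g η ∂ν := by
      refine (StronglyMeasurable.integral_prod_right
        (f := fun x η => E (e n) x η * g η) ?_).measurable
      exact ((hE _).mul (hgm.comp measurable_snd)).stronglyMeasurable
    exact this.enorm.pow_const 2
  have hsup : ∀ x, ⨆ p, ‖∫ η, E p x η * g η ∂ν‖ₑ ^ 2 = ⨆ n, u n x := fun x =>
    iSup_denseSeq_eq ((ENNReal.continuous_pow 2).comp (hcont x).enorm)
  have hsup2 : ∀ x, ⨆ n, u n x = ⨆ n, ⨆ i ≤ n, u i x := fun x =>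
    le_antisymm (iSup_mono fun n => le_iSup₂_of_le n le_rfl le_rfl)
      (iSup_le fun n => iSup₂_le fun i _ => le_iSup (fun n => u n x) i)
  have hvm : ∀ n, Measurable fun x => ⨆ i ≤ n, u i x := fun n =>
    Measurable.iSup fun i => Measurable.iSup fun _ => hum i
  simp_rw [hsup]
  refine ⟨(Measurable.iSup hum).aemeasurable, ?_⟩
  simp_rw [hsup2]
  rw [lintegral_iSup hvm (fun m n hmn x =>
    biSup_mono fun i hi => hi.trans hmn)]
  refine iSup_le fun n => ?_
  -- The kernel bound is uniform in both parameters, so it survives substituting the parameter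
  -- chosen at x and at y. The resulting estimate does not depend on n, and monotone convergence has
  -- already reduced the claim to finite maxima.
  obtain ⟨j, hj, hmax⟩ := exists_measurable_argmax hum n
  have hEj : Measurable (Function.uncurry fun x η => E (e (j x)) x η) := by
    have : Measurable fun q : ℕ × (X × Y) => E (e q.1) q.2.1 q.2.2 :=
      measurable_from_prod_countable_right fun n => hE (e n)
    exact this.comp ((hj.comp measurable_fst).prodMk measurable_id)
  refine le_trans (lintegral_mono fun x => iSup₂_le fun i hi => hmax x i hi) ?_
  exact lintegral_enorm_sq_le_of_kernel hEj (fun x η => hE1 _ _ _) hk hsymm hA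
    (fun x => (hK x).mono fun y hy => hy _ _) hg

end TTStar

/-! ### Truncated exponentials and bounds for the TT* kernel -/

section Maximal

open scoped ENNReal ComplexConjugate

/-- The quadratic exponential cut off to the frequencies `|η| ≤ ρ`. -/
noncomputable def cutExp (ρ A τ η : ℝ) : ℂ := {η | |η| ≤ ρ}.indicator (quadExp A τ) η

theorem norm_cutExp_le (ρ A τ η : ℝ) : ‖cutExp ρ A τ η‖ ≤ 1 :=
  (norm_indicator_le_norm_self _ _).trans (norm_quadExp A τ η).le

/-- This is why a sharp cutoff can be one of the parameters of the maximal function at no cost: the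
TT* kernel is again an integral of a quadratic exponential, over a smaller annulus. -/
theorem cutExp_mul_conj (ρ ρ' A A' τ τ' η : ℝ) :
    cutExp ρ A τ η * conj (cutExp ρ' A' τ' η) = cutExp (min ρ ρ') (A - A') (τ - τ') η := by
  by_cases h : |η| ≤ ρ
  · by_cases h' : |η| ≤ ρ'
    · rw [cutExp, cutExp, cutExp, indicator_of_mem (by exact h), indicator_of_mem (by exact h'),
        indicator_of_mem (by exact le_min h h')]
      rw [quadExp, quadExp, quadExp, ← Complex.exp_conj, ← Complex.exp_add]
      congr 1
      simp only [map_mul, Complex.conj_I, Complex.conj_ofReal]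
      push_cast
      ring
    · rw [cutExp, cutExp, cutExp, indicator_of_notMem (s := {η | |η| ≤ ρ'}) (by exact h'),
        indicator_of_notMem (s := {η | |η| ≤ min ρ ρ'}) (fun h2 => h' (h2.trans (min_le_right _ _)))]
      simp
  · rw [cutExp, cutExp, cutExp, indicator_of_notMem (s := {η | |η| ≤ ρ}) (by exact h),
      indicator_of_notMem (s := {η | |η| ≤ min ρ ρ'}) (fun h2 => h (h2.trans (min_le_left _ _)))]
    simp

theorem measurable_cutExp {Z : Type*} [MeasurableSpace Z] {ρ A τ η : Z → ℝ} (hρ : Measurable ρ)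
    (hA : Measurable A) (hτ : Measurable τ) (hη : Measurable η) :
    Measurable fun z => cutExp (ρ z) (A z) (τ z) (η z) := by
  have h : ∀ z, cutExp (ρ z) (A z) (τ z) (η z) =
      {z | |η z| ≤ ρ z}.indicator (fun z => quadExp (A z) (τ z) (η z)) z := fun z => rfl
  simp_rw [h]
  refine Measurable.indicator ?_ (measurableSet_le hη.norm hρ)
  unfold quadExp
  fun_prop

/-- Lebesgue measure on the dyadic annulus `N < |η| ≤ 2 N`. -/
noncomputable def annulusMeasure (N : ℝ) : Measure ℝ := volume.restrict (freqAnnulus N (2 * N))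

instance (N : ℝ) : IsFiniteMeasure (annulusMeasure N) := by
  refine ⟨?_⟩
  rw [annulusMeasure, Measure.restrict_apply_univ]
  refine lt_of_le_of_lt (measure_mono (t := Icc (-(2 * N)) (2 * N)) fun η hη => abs_le.1 hη.2) ?_
  simp

theorem integral_cutExp_annulusMeasure (N ρ A τ : ℝ) :
    ∫ η, cutExp ρ A τ η ∂annulusMeasure N =
      ∫ η in freqAnnulus N (min ρ (2 * N)), quadExp A τ η := by
  have hm : MeasurableSet {η : ℝ | |η| ≤ ρ} := measurableSet_le measurable_norm measurable_const
  unfold cutExp annulusMeasure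
  rw [integral_indicator hm, Measure.restrict_restrict hm]
  congr 2
  ext η
  simp only [freqAnnulus, mem_inter_iff, mem_ofPred_eq, le_min_iff]
  tauto

/-- The sharp cutoff is discontinuous in the parameter only at |η| = ρ, a null set, so dominated
convergence applies. -/
theorem continuous_integral_cutExp_mul {P : Type*} [TopologicalSpace P]
    [FirstCountableTopology P] {A τ ρ : P → ℝ} (hA : Continuous A) (hτ : Continuous τ)
    (hρ : Continuous ρ) {ν : Measure ℝ} [NullSingletonClass ν] {g : ℝ → ℂ} (hg : Integrable g ν) :
    Continuous fun p => ∫ η, cutExp (ρ p) (A p) (τ p) η * g η ∂ν := by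
  refine continuous_iff_continuousAt.2 fun p₀ => ?_
  refine continuousAt_of_dominated (bound := fun η => ‖g η‖)
    (Eventually.of_forall fun p => ?_) (Eventually.of_forall fun p => ae_of_all _ fun η => ?_)
    hg.norm ?_
  · exact (measurable_cutExp measurable_const measurable_const measurable_const
      measurable_id).aestronglyMeasurable.mul hg.1
  · rw [norm_mul]
    exact mul_le_of_le_one_left (norm_nonneg _) (norm_cutExp_le _ _ _ _)
  · have hnull : ν {ρ p₀, -ρ p₀} = 0 := (Set.toFinite _).measure_zero ν
    filter_upwards [compl_mem_ae_iff.2 hnull] with η hη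
    refine ContinuousAt.mul ?_ continuousAt_const
    have hne : |η| ≠ ρ p₀ := fun h => hη (by
      rcases abs_choice η with h' | h'
      · left; rw [← h, h']
      · right; rw [mem_singleton_iff, ← h, h', neg_neg])
    rcases lt_or_gt_of_ne hne with h | h
    · have hq : ContinuousAt (fun p => quadExp (A p) (τ p) η) p₀ := by
        unfold quadExp
        fun_prop
      refine hq.congr ?_
      filter_upwards [continuousAt_const.eventually_lt hρ.continuousAt h] with p hp
      rw [cutExp, indicator_of_mem (by exact hp.le)]
    · refine (continuousAt_const (y := (0 : ℂ))).congr ?_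
      filter_upwards [hρ.continuousAt.eventually_lt continuousAt_const h] with p hp
      rw [cutExp, indicator_of_notMem (by exact not_le.2 hp)]

instance (N : ℝ) : NullSingletonClass (annulusMeasure N) := by
  unfold annulusMeasure
  infer_instance

/-- The kernel hypothesis ranges over all M ≤ 2N because the product of two cutoffs replaces the
outer radius by min(ρ, ρ', 2N). -/
theorem lintegral_iSup_cutExp_sq_le {X P : Type*} [MeasurableSpace X] [TopologicalSpace P]
    [FirstCountableTopology P] [TopologicalSpace.SeparableSpace P] [Nonempty P]
    {μ : Measure X} [IsFiniteMeasure μ] {A : P → X → ℝ} {τ ρ : P → ℝ}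
    (hA : ∀ p, Measurable (A p)) (hAc : ∀ x, Continuous fun p => A p x) (hτ : Continuous τ)
    (hρ : Continuous ρ) {N : ℝ}
    {k : X → X → ℝ≥0∞} (hk : Measurable (Function.uncurry k))
    (hsymm : ∀ x y, k x y = k y x) {B : ℝ≥0∞} (hB : ∀ x, ∫⁻ y, k x y ∂μ ≤ B)
    (hK : ∀ x, ∀ᵐ y ∂μ, ∀ p p', ∀ M ≤ 2 * N,
      ‖∫ η in freqAnnulus N M, quadExp (A p x - A p' y) (τ p - τ p') η‖ₑ ≤ k x y)
    {g : ℝ → ℂ} (hg : MemLp g 2 (annulusMeasure N)) :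
    AEMeasurable
      (fun x => ⨆ p, ‖∫ η, cutExp (ρ p) (A p x) (τ p) η * g η ∂annulusMeasure N‖ₑ ^ 2) μ ∧
    ∫⁻ x, ⨆ p, ‖∫ η, cutExp (ρ p) (A p x) (τ p) η * g η ∂annulusMeasure N‖ₑ ^ 2 ∂μ ≤
      2 * B * ∫⁻ η, ‖g η‖ₑ ^ 2 ∂annulusMeasure N := by
  refine lintegral_iSup_enorm_sq_le_of_kernel (E := fun p x η => cutExp (ρ p) (A p x) (τ p) η)
    (fun p => ?_) (fun p x η => norm_cutExp_le _ _ _ _) hk hsymm hB (fun x => ?_) hg (fun x => ?_)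
  · exact measurable_cutExp measurable_const ((hA p).comp measurable_fst) measurable_const
      measurable_snd
  · filter_upwards [hK x] with y hy p p'
    simp only [cutExp_mul_conj, integral_cutExp_annulusMeasure]
    exact hy p p' _ (min_le_right _ _)
  · exact continuous_integral_cutExp_mul (hAc x) hτ hρ (hg.integrable (by norm_num))

theorem norm_setIntegral_le_of_separation {N M d c : ℝ} (hN : 0 < N) (hM : M ≤ 2 * N) (hd : 0 < d)
    (hc : 0 < c) {a b : ℝ} (ha : c * d / 2 ≤ |a|) :
    ‖∫ η in freqAnnulus N M, quadExp (2 * Real.pi * a) (4 * Real.pi ^ 2 * b) η‖ ≤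
      34 * c ^ (-(1 / 2) : ℝ) * (N ^ (1 / 2 : ℝ) * d ^ (-(1 / 2) : ℝ)) := by
  have hcd : 0 < c * d := mul_pos hc hd
  have hA : c * d ≤ |2 * Real.pi * a| := by
    rw [abs_mul, abs_of_pos Real.two_pi_pos]
    nlinarith [Real.pi_gt_three]
  refine (norm_setIntegral_freqAnnulus_le_sqrt_div hN hM
    (abs_pos.1 (hcd.trans_le hA)) _).trans ?_
  have h1 : √(N / |2 * Real.pi * a|) ≤ √(N / (c * d)) :=
    Real.sqrt_le_sqrt (div_le_div_of_nonneg_left hN.le hcd hA)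
  have h2 : √(N / (c * d)) = c ^ (-(1 / 2) : ℝ) * (N ^ (1 / 2 : ℝ) * d ^ (-(1 / 2) : ℝ)) := by
    rw [Real.sqrt_eq_rpow, Real.div_rpow hN.le hcd.le, Real.mul_rpow hc.le hd.le,
      Real.rpow_neg hc.le, Real.rpow_neg hd.le]
    field_simp
  rw [h2] at h1
  linarith

/-- Here d, a, b stand for |x − y|, γ(x,t) − γ(y,t') and t − t'. If |a| ≥ cd/2 the linear part of
the phase gives N^(1/2) d^(-1/2), and σ ≥ 1/4 absorbs N^(1/2). Otherwise |b|^α ≳ d, and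
interpolating the length bound N with the second derivative bound |b|^(-1/2) gives N^(2σ)
|b|^(-(1-2σ)/2). -/
theorem exists_curve_kernel_bound {α σ c C : ℝ} (hα : 0 < α) (hσ : 1 / 4 ≤ σ) (hσ' : σ ≤ 1 / 2)
    (hc : 0 < c) (hC : 0 < C) :
    ∃ K : ℝ, 0 ≤ K ∧ ∀ N M d a b : ℝ, 1 ≤ N → M ≤ 2 * N → 0 < d → c * d - C * |b| ^ α ≤ |a| →
      ‖∫ η in freqAnnulus N M, quadExp (2 * Real.pi * a) (4 * Real.pi ^ 2 * b) η‖ ≤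
        K * N ^ (2 * σ) * (d ^ (-(1 / 2) : ℝ) + d ^ (-((1 - 2 * σ) / (2 * α)))) := by
  set q := (1 - 2 * σ) / (2 * α) with hq
  refine ⟨34 * c ^ (-(1 / 2) : ℝ) + 24 * (c / (2 * C)) ^ (-q), by positivity,
    fun N M d a b hN hM hd hab => ?_⟩
  have hN0 : 0 < N := by linarith
  have hcd : 0 < c * d := mul_pos hc hd
  rcases le_total (c * d / 2) |a| with h | h
  · refine (norm_setIntegral_le_of_separation hN0 hM hd hc h).trans ?_
    have h1 : N ^ (1 / 2 : ℝ) ≤ N ^ (2 * σ) := Real.rpow_le_rpow_of_exponent_le hN (by linarith)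
    calc 34 * c ^ (-(1 / 2) : ℝ) * (N ^ (1 / 2 : ℝ) * d ^ (-(1 / 2) : ℝ))
        ≤ 34 * c ^ (-(1 / 2) : ℝ) * (N ^ (2 * σ) * d ^ (-(1 / 2) : ℝ)) := by gcongr
      _ = 34 * c ^ (-(1 / 2) : ℝ) * N ^ (2 * σ) * d ^ (-(1 / 2) : ℝ) := by ring
      _ ≤ _ := by
        gcongr
        · exact le_add_of_nonneg_right (by positivity)
        · exact le_add_of_nonneg_right (by positivity)
  · have hb : c / (2 * C) * d ≤ |b| ^ α := by
      rw [div_mul_eq_mul_div, div_le_iff₀ (by positivity)]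
      linarith
    have hb0 : 0 < |b| := by
      refine lt_of_le_of_ne (abs_nonneg _) fun h0 => ?_
      rw [← h0, Real.zero_rpow hα.ne'] at hb
      have : 0 < c / (2 * C) * d := by positivity
      linarith
    have hτ : |b| ≤ |4 * Real.pi ^ 2 * b| := by
      rw [abs_mul, abs_of_pos (a := 4 * Real.pi ^ 2) (by positivity)]
      refine le_mul_of_one_le_left (abs_nonneg _) ?_
      nlinarith [Real.pi_gt_three]
    set J := ‖∫ η in freqAnnulus N M, quadExp (2 * Real.pi * a) (4 * Real.pi ^ 2 * b) η‖ with hJ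
    have hJ0 : 0 ≤ J := norm_nonneg _
    have hJ1 : J ≤ 2 * N := norm_setIntegral_freqAnnulus_le hN0 hM _ _
    have hJ2 : J ≤ 12 * |b| ^ (-(1 / 2) : ℝ) := by
      refine (norm_setIntegral_freqAnnulus_le_sqrt hN0 _
        (abs_pos.1 (hb0.trans_le hτ))).trans ?_
      rw [Real.rpow_neg hb0.le, ← Real.sqrt_eq_rpow, ← div_eq_mul_inv]
      exact div_le_div_of_nonneg_left (by norm_num) (Real.sqrt_pos.2 hb0) (Real.sqrt_le_sqrt hτ)
    -- The exponent 2σ goes on the length bound so that the loss is exactly N^(2σ); the remaining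
    -- power of |b| equals (|b|^α)^(-q).
    have hsplit : J = J ^ (2 * σ) * J ^ (1 - 2 * σ) := by
      rcases eq_or_lt_of_le hJ0 with h0 | h0
      · rw [← h0, Real.zero_rpow (by linarith : 2 * σ ≠ 0), zero_mul]
      · rw [← Real.rpow_add h0]; simp
    have hθ : 0 ≤ 1 - 2 * σ := by linarith
    have e1 : J ^ (2 * σ) ≤ 2 * N ^ (2 * σ) := by
      calc J ^ (2 * σ) ≤ (2 * N) ^ (2 * σ) := Real.rpow_le_rpow hJ0 hJ1 (by linarith)
        _ = 2 ^ (2 * σ) * N ^ (2 * σ) := Real.mul_rpow (by norm_num) hN0.le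
        _ ≤ 2 ^ (1 : ℝ) * N ^ (2 * σ) := by
          gcongr
          · norm_num
          · linarith
        _ = _ := by rw [Real.rpow_one]
    have e2 : J ^ (1 - 2 * σ) ≤ 12 * ((c / (2 * C)) ^ (-q) * d ^ (-q)) := by
      calc J ^ (1 - 2 * σ) ≤ (12 * |b| ^ (-(1 / 2) : ℝ)) ^ (1 - 2 * σ) :=
            Real.rpow_le_rpow hJ0 hJ2 hθ
        _ = 12 ^ (1 - 2 * σ) * (|b| ^ α) ^ (-q) := by
          rw [Real.mul_rpow (by norm_num) (by positivity), ← Real.rpow_mul hb0.le,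
            ← Real.rpow_mul hb0.le]
          congr 2
          rw [hq]; field_simp
        _ ≤ 12 ^ (1 : ℝ) * (c / (2 * C) * d) ^ (-q) := by
          refine mul_le_mul (Real.rpow_le_rpow_of_exponent_le (by norm_num) (by linarith))
            (Real.rpow_le_rpow_of_nonpos (by positivity) hb ?_) (by positivity) (by positivity)
          rw [neg_nonpos, hq]
          positivity
        _ = _ := by rw [Real.mul_rpow (by positivity) hd.le, Real.rpow_one]
    calc J = J ^ (2 * σ) * J ^ (1 - 2 * σ) := hsplit
      _ ≤ (2 * N ^ (2 * σ)) * (12 * ((c / (2 * C)) ^ (-q) * d ^ (-q))) := by gcongr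
      _ = 24 * (c / (2 * C)) ^ (-q) * N ^ (2 * σ) * d ^ (-q) := by ring
      _ ≤ _ := by
        gcongr
        · exact le_add_of_nonneg_left (by positivity)
        · exact le_add_of_nonneg_left (by positivity)

/-- Two points each displaced by at most c/N remain d/2 apart unless d ≤ 4c/N; in that range the
trivial bound 2N is already of size N^(1/2) d^(-1/2). -/
theorem exists_perturbation_kernel_bound (c : ℝ) :
    ∃ K : ℝ, 0 ≤ K ∧ ∀ N M d a b : ℝ, 1 ≤ N → M ≤ 2 * N → 0 < d → d - 2 * (c / N) ≤ |a| →
      ‖∫ η in freqAnnulus N M, quadExp (2 * Real.pi * a) (4 * Real.pi ^ 2 * b) η‖ ≤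
        K * N ^ (1 / 2 : ℝ) * d ^ (-(1 / 2) : ℝ) := by
  refine ⟨34 + 4 * √c, by positivity, fun N M d a b hN hM hd hab => ?_⟩
  have hN0 : 0 < N := by linarith
  rcases le_total (1 * d / 2) |a| with h | h
  · refine (norm_setIntegral_le_of_separation hN0 hM hd one_pos h).trans ?_
    rw [Real.one_rpow, mul_one, mul_assoc]
    gcongr
    exact le_add_of_nonneg_right (by positivity)
  · refine (norm_setIntegral_freqAnnulus_le hN0 hM _ _).trans ?_
    have h1 : d * N ≤ 4 * c := by
      have : d ≤ 4 * (c / N) := by linarith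
      calc d * N ≤ 4 * (c / N) * N := by gcongr
        _ = 4 * c := by field_simp
    have h2 : N ≤ 2 * √c * (N ^ (1 / 2 : ℝ) * d ^ (-(1 / 2) : ℝ)) := by
      rw [Real.rpow_neg hd.le, ← Real.sqrt_eq_rpow, ← Real.sqrt_eq_rpow]
      have hsd : 0 < √d := Real.sqrt_pos.2 hd
      rw [← div_eq_mul_inv, mul_div_assoc', le_div_iff₀ hsd]
      have h3 : √N * √d ≤ 2 * √c := by
        rw [← Real.sqrt_mul hN0.le, show (2 : ℝ) * √c = √(4 * c) by
          rw [Real.sqrt_mul (by norm_num), show (4 : ℝ) = 2 ^ 2 by norm_num,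
            Real.sqrt_sq (by norm_num)]]
        exact Real.sqrt_le_sqrt (by linarith)
      calc N * √d = √N * (√N * √d) := by rw [← mul_assoc, Real.mul_self_sqrt hN0.le]
        _ ≤ √N * (2 * √c) := by gcongr
        _ = _ := by ring
    have h4 : 0 ≤ N ^ (1 / 2 : ℝ) * d ^ (-(1 / 2) : ℝ) := by positivity
    calc 2 * N ≤ 4 * √c * (N ^ (1 / 2 : ℝ) * d ^ (-(1 / 2) : ℝ)) := by linarith
      _ ≤ (34 + 4 * √c) * (N ^ (1 / 2 : ℝ) * d ^ (-(1 / 2) : ℝ)) := by gcongr; linarith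
      _ = _ := by ring

/-- Lebesgue measure on a ball, as a measure on the subtype. -/
noncomputable def ballMeasure (x₀ r : ℝ) : Measure (Metric.ball x₀ r) :=
  Measure.comap Subtype.val volume

instance (x₀ r : ℝ) : IsFiniteMeasure (ballMeasure x₀ r) := by
  refine ⟨?_⟩
  rw [ballMeasure, comap_subtype_coe_apply Metric.isOpen_ball.measurableSet]
  exact lt_of_le_of_lt (measure_mono (Subtype.coe_image_subset _ _)) measure_ball_lt_top

instance (x₀ r : ℝ) : NullSingletonClass (ballMeasure x₀ r) := by
  refine ⟨fun x => ?_⟩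
  rw [ballMeasure, comap_subtype_coe_apply Metric.isOpen_ball.measurableSet, image_singleton]
  exact measure_singleton _

/-- The marginal bound for Schur's test: x − y stays in [−2r, 2r], so one integral of |u|^(-q)
dominates uniformly in x. -/
theorem exists_lintegral_abs_sub_rpow_le (x₀ r : ℝ) {q : ℝ} (hq : q < 1) :
    ∃ B : ℝ≥0∞, B ≠ ∞ ∧ ∀ x : Metric.ball x₀ r,
      ∫⁻ y : Metric.ball x₀ r, ENNReal.ofReal (|(x : ℝ) - y| ^ (-q)) ∂ballMeasure x₀ r ≤ B := by
  refine ⟨∫⁻ u in Icc (-(2 * r)) (2 * r), ENNReal.ofReal (|u| ^ (-q)), ?_, fun x => ?_⟩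
  · have hI : IntegrableOn (fun u : ℝ => |u| ^ (-q)) (Icc (-(2 * r)) (2 * r)) := by
      have hp : ∀ a : ℝ, 0 ≤ a → IntegrableOn (fun u : ℝ => |u| ^ (-q)) (Ioc 0 a) := fun a ha => by
        have := (intervalIntegral.intervalIntegrable_rpow' (a := 0) (b := a) (r := -q) (by linarith))
        rw [intervalIntegrable_iff_integrableOn_Ioc_of_le ha] at this
        exact this.congr_fun (fun u hu => by simp only [abs_of_pos hu.1]) measurableSet_Ioc
      rcases le_total 0 r with hr | hr
      · have h1 := hp (2 * r) (by linarith)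
        have h2 : IntegrableOn (fun u : ℝ => |u| ^ (-q)) (Ico (-(2 * r)) 0) := by
          have h3 := (integrableOn_Ioc_iff_integrableOn_Ioo enorm_ne_top).1 h1
          have h4 : IntegrableOn (fun u : ℝ => |u| ^ (-q)) (Ioo (-(2 * r)) 0) := by
            have := h3.comp_neg
            simpa using this
          exact (integrableOn_Ico_iff_integrableOn_Ioo enorm_ne_top).2 h4
        have h3 := (integrableOn_Icc_iff_integrableOn_Ioc enorm_ne_top).2 h1
        exact (h2.union h3).mono_set fun u hu => by
          rcases lt_or_ge u 0 with h | h
          · exact Or.inl ⟨hu.1, h⟩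
          · exact Or.inr ⟨h, hu.2⟩
      · rcases eq_or_lt_of_le hr with rfl | hr
        · simp
        · rw [Icc_eq_empty (by linarith)]; exact integrableOn_empty
    have := hI.lintegral_lt_top
    exact this.ne
  · have hm : MeasurableSet (Metric.ball x₀ r) := Metric.isOpen_ball.measurableSet
    calc ∫⁻ y : Metric.ball x₀ r, ENNReal.ofReal (|(x : ℝ) - y| ^ (-q)) ∂ballMeasure x₀ r
        = ∫⁻ y in Metric.ball x₀ r, ENNReal.ofReal (|(x : ℝ) - y| ^ (-q)) :=
          lintegral_subtype_comap hm (fun y : ℝ => ENNReal.ofReal (|(x : ℝ) - y| ^ (-q)))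
      _ = ∫⁻ y, (Metric.ball x₀ r).indicator
            (fun y => ENNReal.ofReal (|(x : ℝ) - y| ^ (-q))) y := (lintegral_indicator hm _).symm
      _ ≤ ∫⁻ y, (Icc (-(2 * r)) (2 * r)).indicator
            (fun u => ENNReal.ofReal (|u| ^ (-q))) ((x : ℝ) - y) := by
          refine lintegral_mono fun y => ?_
          by_cases hy : y ∈ Metric.ball x₀ r
          swap
          · rw [indicator_of_notMem hy]; exact zero_le
          rw [indicator_of_mem hy]
          have hxy : (x : ℝ) - y ∈ Icc (-(2 * r)) (2 * r) := by
            have h1 : (x : ℝ) ∈ Ioo (x₀ - r) (x₀ + r) := by rw [← Real.ball_eq_Ioo]; exact x.2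
            have h2 : y ∈ Ioo (x₀ - r) (x₀ + r) := by rwa [← Real.ball_eq_Ioo]
            exact ⟨by linarith [h1.1, h2.2], by linarith [h1.2, h2.1]⟩
          rw [indicator_of_mem hxy]
      _ = ∫⁻ u, (Icc (-(2 * r)) (2 * r)).indicator (fun u => ENNReal.ofReal (|u| ^ (-q))) u :=
          lintegral_sub_left_eq_self _ _
      _ = _ := lintegral_indicator measurableSet_Icc _

end Maximal

/-! ### Maximal estimates on a dyadic annulus -/

section CurveMaximal

open scoped ENNReal ComplexConjugate

theorem lintegral_iSup_cutExp_sq_le_of_norm_le {P : Type*} [TopologicalSpace P]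
    [FirstCountableTopology P] [TopologicalSpace.SeparableSpace P] [Nonempty P] {x₀ r : ℝ}
    {a : P → Metric.ball x₀ r → ℝ} {t ρ : P → ℝ}
    (ha : ∀ p, Measurable (a p)) (hac : ∀ x, Continuous fun p => a p x) (ht : Continuous t)
    (hρ : Continuous ρ) {N K q : ℝ} (hK0 : 0 ≤ K) {B B' : ℝ≥0∞}
    (hB : ∀ x : Metric.ball x₀ r,
      ∫⁻ y : Metric.ball x₀ r, ENNReal.ofReal (|(x : ℝ) - y| ^ (-(1 / 2) : ℝ))
        ∂ballMeasure x₀ r ≤ B)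
    (hB' : ∀ x : Metric.ball x₀ r,
      ∫⁻ y : Metric.ball x₀ r, ENNReal.ofReal (|(x : ℝ) - y| ^ (-q)) ∂ballMeasure x₀ r ≤ B')
    (hK : ∀ x y : Metric.ball x₀ r, x ≠ y → ∀ p p', ∀ M ≤ 2 * N,
      ‖∫ η in freqAnnulus N M, quadExp (2 * Real.pi * (a p x - a p' y))
        (4 * Real.pi ^ 2 * (t p - t p')) η‖ ≤
      K * (|(x : ℝ) - y| ^ (-(1 / 2) : ℝ) + |(x : ℝ) - y| ^ (-q)))
    {g : ℝ → ℂ} (hg : MemLp g 2 (annulusMeasure N)) :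
    AEMeasurable (fun x => ⨆ p, ‖∫ η, cutExp (ρ p) (2 * Real.pi * a p x)
        (4 * Real.pi ^ 2 * t p) η * g η ∂annulusMeasure N‖ₑ ^ 2) (ballMeasure x₀ r) ∧
    ∫⁻ x, ⨆ p, ‖∫ η, cutExp (ρ p) (2 * Real.pi * a p x)
        (4 * Real.pi ^ 2 * t p) η * g η ∂annulusMeasure N‖ₑ ^ 2 ∂ballMeasure x₀ r ≤
      2 * (ENNReal.ofReal K * (B + B')) * ∫⁻ η, ‖g η‖ₑ ^ 2 ∂annulusMeasure N := by
  refine lintegral_iSup_cutExp_sq_le (A := fun p x => 2 * Real.pi * a p x)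
    (τ := fun p => 4 * Real.pi ^ 2 * t p)
    (k := fun x y => ENNReal.ofReal K * (ENNReal.ofReal (|(x : ℝ) - y| ^ (-(1 / 2) : ℝ)) +
      ENNReal.ofReal (|(x : ℝ) - y| ^ (-q))))
    (fun p => (ha p).const_mul _) (fun x => continuous_const.mul (hac x))
    (continuous_const.mul ht) hρ (by fun_prop) (fun x y => by simp_rw [abs_sub_comm])
    (fun x => ?_) (fun x => ?_) hg
  · rw [lintegral_const_mul _ (by fun_prop), lintegral_add_left (by fun_prop)]
    gcongr
    · exact hB x
    · exact hB' x
  · have hne : ∀ᵐ y ∂ballMeasure x₀ r, y ≠ x := by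
      rw [ae_iff]
      simp
    filter_upwards [hne] with y hy p p' M hM
    rw [← ofReal_norm, ← ENNReal.ofReal_add (by positivity) (by positivity),
      ← ENNReal.ofReal_mul hK0]
    refine ENNReal.ofReal_le_ofReal ?_
    have := hK x y hy.symm p p' M hM
    simpa only [mul_sub] using this

/-- Maximal estimate along curves, for frequencies in a dyadic annulus. -/
theorem exists_curve_maximal_bound {α x₀ r t₀ T σ : ℝ} {γ : ℝ → ℝ → ℝ} (hα : 0 < α)
    (h0 : (0 : ℝ) ∈ Ico (t₀ - T) (t₀ + T)) (hγ : IsBilipHolderCurve α x₀ r t₀ T γ)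
    (hσ : 1 / 4 < σ) (hσ' : σ < 1 / 2) (hσα : 1 / 2 - α < σ) :
    ∃ C : ℝ≥0∞, C ≠ ∞ ∧ ∀ N : ℝ, 1 ≤ N → ∀ g : ℝ → ℂ, MemLp g 2 (annulusMeasure N) →
      AEMeasurable (fun x : Metric.ball x₀ r => ⨆ p : Icc 0 (t₀ + T) × Icc N (2 * N),
        ‖∫ η, cutExp p.2 (2 * Real.pi * γ x p.1) (4 * Real.pi ^ 2 * p.1) η * g η
          ∂annulusMeasure N‖ₑ ^ 2) (ballMeasure x₀ r) ∧
      ∫⁻ x : Metric.ball x₀ r, ⨆ p : Icc 0 (t₀ + T) × Icc N (2 * N),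
        ‖∫ η, cutExp p.2 (2 * Real.pi * γ x p.1) (4 * Real.pi ^ 2 * p.1) η * g η
          ∂annulusMeasure N‖ₑ ^ 2 ∂ballMeasure x₀ r ≤
      C * ENNReal.ofReal (N ^ (2 * σ)) * ∫⁻ η, ‖g η‖ₑ ^ 2 ∂annulusMeasure N := by
  obtain ⟨C, hC⟩ := hγ.holder
  obtain ⟨c, c₂, hc, hbil⟩ := hγ.bilipschitz
  -- Local integrability of the kernel, and the only place where σ > 1/2 − α is needed.
  have hq : (1 - 2 * σ) / (2 * α) < 1 := by
    rw [div_lt_one (by positivity)]; linarith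
  -- The Hölder constant comes without a sign, and the kernel bound requires a positive one.
  obtain ⟨K, hK0, hK⟩ := exists_curve_kernel_bound (C := |C| + 1) hα hσ.le hσ'.le hc (by positivity)
  obtain ⟨B, hBtop, hB⟩ := exists_lintegral_abs_sub_rpow_le x₀ r (q := 1 / 2) (by norm_num)
  obtain ⟨B', hBtop', hB'⟩ := exists_lintegral_abs_sub_rpow_le x₀ r hq
  have hmem : ∀ t ∈ Icc 0 (t₀ + T), t ∈ Icc (t₀ - T) (t₀ + T) := fun t ht =>
    ⟨h0.1.trans ht.1, ht.2⟩
  refine ⟨2 * (ENNReal.ofReal K * (B + B')), by finiteness, fun N hN g hg => ?_⟩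
  have : Nonempty (Icc 0 (t₀ + T) × Icc N (2 * N)) :=
    ⟨⟨⟨0, left_mem_Icc.2 h0.2.le⟩, ⟨N, left_mem_Icc.2 (by linarith)⟩⟩⟩
  have main := lintegral_iSup_cutExp_sq_le_of_norm_le (P := Icc 0 (t₀ + T) × Icc N (2 * N))
    (a := fun p (x : Metric.ball x₀ r) => γ x p.1) (t := fun p => (p.1 : ℝ))
    (ρ := fun p => (p.2 : ℝ)) (N := N) (K := K * N ^ (2 * σ)) (q := (1 - 2 * σ) / (2 * α))
    (fun p => ?_) (fun x => ?_) (by fun_prop) (by fun_prop) (by positivity) hB hB'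
    (fun x y hxy p p' M hM => ?_) hg
  · refine ⟨main.1, main.2.trans (le_of_eq ?_)⟩
    rw [ENNReal.ofReal_mul hK0]
    ring
  · have : LipschitzWith c₂.toNNReal (fun x : Metric.ball x₀ r => γ x p.1) :=
      LipschitzWith.of_dist_le_mul fun x y => by
        rw [Real.dist_eq, Subtype.dist_eq, Real.dist_eq]
        refine (hbil x x.2 y y.2 p.1 (hmem _ p.1.2)).2.trans ?_
        exact mul_le_mul_of_nonneg_right (Real.le_coe_toNNReal _) (abs_nonneg _)
    exact this.continuous.measurable
  · have hct : Continuous fun t : Icc 0 (t₀ + T) => γ x t := by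
      refine continuous_iff_continuousAt.2 fun t => ?_
      rw [ContinuousAt, tendsto_iff_dist_tendsto_zero]
      have hlim : Tendsto (fun s : Icc 0 (t₀ + T) => C * |(s : ℝ) - t| ^ α) (𝓝 t) (𝓝 0) := by
        have hcont : Continuous fun s : Icc 0 (t₀ + T) => C * |(s : ℝ) - t| ^ α :=
          continuous_const.mul (Continuous.rpow_const (by fun_prop) fun _ => Or.inr hα.le)
        have := hcont.tendsto t
        simpa [Real.zero_rpow hα.ne'] using this
      exact squeeze_zero (fun _ => dist_nonneg)
        (fun s => hC x x.2 s (hmem _ s.2) t (hmem _ t.2)) hlim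
    exact hct.comp continuous_fst
  · have hd : 0 < |(x : ℝ) - y| := abs_pos.2 (sub_ne_zero.2 fun h => hxy (Subtype.ext h))
    refine hK N M _ _ _ hN hM hd ?_
    -- Compare the two curves at the common time t, then move the second one from t to t' at Hölder
    -- cost.
    have h1 := (hbil x x.2 y y.2 p.1 (hmem _ p.1.2)).1
    have h2 := hC y y.2 p.1 (hmem _ p.1.2) p'.1 (hmem _ p'.1.2)
    have h3 : |γ x p.1 - γ y p.1| ≤ |γ x p.1 - γ y p'.1| + |γ y p.1 - γ y p'.1| := by
      have := abs_sub_le (γ x p.1) (γ y p'.1) (γ y p.1)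
      rwa [abs_sub_comm (γ y p'.1)] at this
    have h4 : C * |(p.1 : ℝ) - p'.1| ^ α ≤ (|C| + 1) * |(p.1 : ℝ) - p'.1| ^ α := by
      gcongr
      linarith [le_abs_self C]
    linarith

/-- Maximal estimate over spatial perturbations of size `c / N`, for frequencies in a dyadic
annulus. -/
theorem exists_perturbation_maximal_bound (x₀ r T : ℝ) (hT : 0 ≤ T) {c : ℝ} (hc : 0 ≤ c) :
    ∃ C : ℝ≥0∞, C ≠ ∞ ∧ ∀ N : ℝ, 1 ≤ N → ∀ g : ℝ → ℂ, MemLp g 2 (annulusMeasure N) →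
      AEMeasurable (fun x : Metric.ball x₀ r => ⨆ p : Icc (-(c / N)) (c / N) × Icc 0 T,
        ‖∫ η, cutExp (2 * N) (2 * Real.pi * (x + p.1)) (4 * Real.pi ^ 2 * p.2) η * g η
          ∂annulusMeasure N‖ₑ ^ 2) (ballMeasure x₀ r) ∧
      ∫⁻ x : Metric.ball x₀ r, ⨆ p : Icc (-(c / N)) (c / N) × Icc 0 T,
        ‖∫ η, cutExp (2 * N) (2 * Real.pi * (x + p.1)) (4 * Real.pi ^ 2 * p.2) η * g η
          ∂annulusMeasure N‖ₑ ^ 2 ∂ballMeasure x₀ r ≤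
      C * ENNReal.ofReal (N ^ (1 / 2 : ℝ)) * ∫⁻ η, ‖g η‖ₑ ^ 2 ∂annulusMeasure N := by
  obtain ⟨K, hK0, hK⟩ := exists_perturbation_kernel_bound c
  obtain ⟨B, hBtop, hB⟩ := exists_lintegral_abs_sub_rpow_le x₀ r (q := 1 / 2) (by norm_num)
  refine ⟨2 * (ENNReal.ofReal K * (B + B)), by finiteness, fun N hN g hg => ?_⟩
  have hcN : 0 ≤ c / N := by positivity
  have : Nonempty (Icc (-(c / N)) (c / N) × Icc 0 T) :=
    ⟨⟨⟨0, by simpa using hcN⟩, ⟨0, left_mem_Icc.2 hT⟩⟩⟩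
  have main := lintegral_iSup_cutExp_sq_le_of_norm_le (P := Icc (-(c / N)) (c / N) × Icc 0 T)
    (a := fun p (x : Metric.ball x₀ r) => (x : ℝ) + p.1) (t := fun p => (p.2 : ℝ))
    (ρ := fun _ => 2 * N) (N := N) (K := K * N ^ (1 / 2 : ℝ)) (q := 1 / 2)
    (fun p => by fun_prop) (fun x => by fun_prop) (by fun_prop) (by fun_prop) (by positivity)
    hB hB (fun x y hxy p p' M hM => ?_) hg
  · refine ⟨main.1, main.2.trans (le_of_eq ?_)⟩
    rw [ENNReal.ofReal_mul hK0]
    ring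
  · have hd : 0 < |(x : ℝ) - y| := abs_pos.2 (sub_ne_zero.2 fun h => hxy (Subtype.ext h))
    refine (hK N M _ _ _ hN hM hd ?_).trans ?_
    · have h1 : |(p.1 : ℝ)| ≤ c / N := abs_le.2 p.1.2
      have h2 : |(p'.1 : ℝ)| ≤ c / N := abs_le.2 p'.1.2
      have h3 : |(x : ℝ) - y| ≤ |(x + p.1 : ℝ) - (y + p'.1)| + |(p.1 : ℝ) - p'.1| := by
        have e : (x : ℝ) - y = ((x + p.1 : ℝ) - (y + p'.1)) - ((p.1 : ℝ) - p'.1) := by ring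
        exact e ▸ abs_sub ((x + p.1 : ℝ) - (y + p'.1)) ((p.1 : ℝ) - p'.1)
      have h4 := abs_sub (p.1 : ℝ) p'.1
      linarith
    · gcongr
      exact le_add_of_nonneg_right (by positivity)

end CurveMaximal

/-! ### Sobolev regularity and pointwise Fourier inversion -/

section Fourier

open scoped ENNReal ComplexConjugate

/-- Sobolev regularity supplies an L² representative of a tempered distribution; testing against
smooth compactly supported functions identifies it almost everywhere with the weighted L² Fourier
transform. -/
theorem memLp_rpow_mul_fourier_of_memSobolev {σ : ℝ} {f : Lp ℂ 2 (volume : Measure ℝ)}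
    (hf : TemperedDistribution.MemSobolev σ 2 (f : 𝓢'(ℝ, ℂ))) :
    MemLp (fun η : ℝ => (((1 + ‖η‖ ^ 2) ^ (σ / 2) : ℝ) : ℂ) *
      (𝓕 f : Lp ℂ 2 (volume : Measure ℝ)) η) 2 := by
  obtain ⟨f', hf'⟩ := TemperedDistribution.memSobolev_iff_exists_smulLeftCLM_fourier.1 hf
  have hw : Continuous fun η : ℝ => (((1 + ‖η‖ ^ 2) ^ (σ / 2) : ℝ) : ℂ) := by
    refine Complex.continuous_ofReal.comp (Continuous.rpow_const (by fun_prop) fun η => Or.inl ?_)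
    positivity
  have hwt : Function.HasTemperateGrowth fun η : ℝ => (((1 + ‖η‖ ^ 2) ^ (σ / 2) : ℝ) : ℂ) := by
    fun_prop
  refine (memLp_congr_ae ?_).1 (Lp.memLp f')
  refine ae_eq_of_integral_contDiff_smul_eq ((Lp.memLp f').locallyIntegrable (by norm_num)) ?_ ?_
  · have h1 := (Lp.memLp (𝓕 f : Lp ℂ 2 (volume : Measure ℝ))).locallyIntegrable (by norm_num)
    rw [← locallyIntegrableOn_univ] at h1 ⊢
    exact h1.continuousOn_mul hw.continuousOn isOpen_univ.isLocallyClosed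
  · intro g hg hgc
    have hg₁ : HasCompactSupport (Complex.ofRealCLM ∘ g) := hgc.comp_left rfl
    have hg₂ : ContDiff ℝ (⊤ : ℕ∞) (Complex.ofRealCLM ∘ g) := by fun_prop
    have h := congrArg (fun u : 𝓢'(ℝ, ℂ) => u (hg₁.toSchwartzMap hg₂)) hf'
    simp only [TemperedDistribution.smulLeftCLM_apply_apply,
      Lp.fourier_toTemperedDistribution_eq, Lp.toTemperedDistribution_apply] at h
    simp only [SchwartzMap.smulLeftCLM_apply_apply hwt] at h
    simp only [HasCompactSupport.toSchwartzMap_toFun, smul_eq_mul, Function.comp_apply,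
      Complex.ofRealCLM_apply] at h
    simp only [Complex.real_smul]
    rw [← h]
    refine integral_congr_ae (Eventually.of_forall fun η => ?_)
    simp only
    ring

/-- On `L¹ ∩ L²`, the inverse `L²` Fourier transform is given by the inverse Fourier integral. -/
theorem fourierInv_toLp_ae_eq {g : ℝ → ℂ} (hg : Integrable g) (hg2 : MemLp g 2) :
    ((𝓕⁻ (hg2.toLp g) : Lp ℂ 2 (volume : Measure ℝ)) : ℝ → ℂ) =ᵐ[volume] 𝓕⁻ g := by
  have hL : Continuous fun p : ℝ × ℝ => (-innerₗ ℝ) p.1 p.2 := by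
    simp only [LinearMap.neg_apply, innerₗ_apply_apply]
    fun_prop
  have hcont : Continuous (𝓕⁻ g) :=
    VectorFourier.fourierIntegral_continuous Real.continuous_fourierChar hL hg
  refine ae_eq_of_integral_contDiff_smul_eq ((Lp.memLp _).locallyIntegrable (by norm_num))
    hcont.locallyIntegrable fun φ hφ hφc => ?_
  have h1 : HasCompactSupport (Complex.ofRealCLM ∘ φ) := hφc.comp_left rfl
  have h2 : ContDiff ℝ (⊤ : ℕ∞) (Complex.ofRealCLM ∘ φ) := by fun_prop
  set ψ : 𝓢(ℝ, ℂ) := h1.toSchwartzMap h2 with hψ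
  have hψφ : ∀ x, ψ x = (φ x : ℂ) := fun x => rfl
  have h := congrArg (fun u : 𝓢'(ℝ, ℂ) => u ψ) (Lp.fourierInv_toTemperedDistribution_eq (hg2.toLp g))
  simp only [TemperedDistribution.fourierInv_apply, Lp.toTemperedDistribution_apply] at h
  have h3 : ∫ x, φ x • (𝓕⁻ (hg2.toLp g) : Lp ℂ 2 (volume : Measure ℝ)) x =
      ∫ x, (𝓕⁻ ψ) x • g x := by
    calc _ = ∫ x, ψ x • (𝓕⁻ (hg2.toLp g) : Lp ℂ 2 (volume : Measure ℝ)) x := by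
          simp only [hψφ, Complex.real_smul, smul_eq_mul]
      _ = ∫ x, (𝓕⁻ ψ) x • (hg2.toLp g) x := h.symm
      _ = _ := integral_congr_ae (hg2.coeFn_toLp.mono fun x hx => by simp only [hx])
  rw [h3]
  have h4 := VectorFourier.integral_fourierIntegral_smul_eq_flip (μ := volume) (ν := volume)
    (e := Real.fourierChar) (L := -innerₗ ℝ) (f := fun x => ψ x) (g := g)
    Real.continuous_fourierChar hL ψ.integrable hg
  have hflip : (-innerₗ ℝ).flip = -innerₗ ℝ := by
    ext
    simp
  rw [hflip] at h4
  rw [SchwartzMap.fourierInv_coe]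
  refine h4.trans ?_
  simp only [hψφ, Complex.real_smul, smul_eq_mul]
  rfl

theorem schrodingerTrunc_eq_integral_quadExp (f : Lp ℂ 2 (volume : Measure ℝ)) (t y R : ℝ) :
    schrodingerTrunc f t y R = ∫ η in (-R)..R,
      quadExp (2 * Real.pi * y) (4 * Real.pi ^ 2 * t) η *
        (𝓕 f : Lp ℂ 2 (volume : Measure ℝ)) η := by
  unfold schrodingerTrunc quadExp
  congr 1
  ext η
  congr 4
  ring

/-- Plancherel gives L² convergence of the truncations, hence almost everywhere convergence along a
subsequence. That is enough to identify the limit once the full limit is known to exist. -/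
theorem exists_seq_schrodingerTrunc_zero_tendsto_ae (f : Lp ℂ 2 (volume : Measure ℝ)) :
    ∃ ns : ℕ → ℕ, StrictMono ns ∧ ∀ᵐ x : ℝ,
      Tendsto (fun i => schrodingerTrunc f 0 x (2 ^ ns i)) atTop (𝓝 (f x)) := by
  set F : Lp ℂ 2 (volume : Measure ℝ) := 𝓕 f with hF
  have hm : ∀ n : ℕ, MeasurableSet (Ioc (-(2 ^ n) : ℝ) (2 ^ n)) := fun n => measurableSet_Ioc
  have hmem : ∀ n : ℕ, MemLp ((Ioc (-(2 ^ n) : ℝ) (2 ^ n)).indicator F) 2 := fun n =>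
    (Lp.memLp F).indicator (hm n)
  have hint : ∀ n : ℕ, Integrable ((Ioc (-(2 ^ n) : ℝ) (2 ^ n)).indicator F) := fun n => by
    rw [integrable_indicator_iff (hm n)]
    have : IsFiniteMeasure (volume.restrict (Ioc (-(2 ^ n) : ℝ) (2 ^ n))) := by
      refine ⟨?_⟩; simp
    exact ((Lp.memLp F).restrict _).integrable (by norm_num)
  have hlim : Tendsto (fun n => (hmem n).toLp _) atTop (𝓝 F) := by
    rw [Lp.tendsto_Lp_iff_tendsto_eLpNorm']
    have heq : ∀ n : ℕ, eLpNorm (((hmem n).toLp _ : Lp ℂ 2 (volume : Measure ℝ)) - F : ℝ → ℂ) 2 =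
        (∫⁻ η, ((Ioc (-(2 ^ n) : ℝ) (2 ^ n))ᶜ).indicator (fun η => ‖F η‖ₑ ^ 2) η) ^ (1 / 2 : ℝ) := by
      intro n
      rw [eLpNorm_eq_lintegral_rpow_enorm_toReal (by norm_num) (by norm_num)]
      simp only [ENNReal.toReal_ofNat, ENNReal.rpow_ofNat]
      congr 1
      refine lintegral_congr_ae ((hmem n).coeFn_toLp.mono fun η hη => ?_)
      simp only [Pi.sub_apply, hη]
      by_cases h : η ∈ Ioc (-(2 ^ n) : ℝ) (2 ^ n)
      · simp [h]
      · simp [h]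
    simp_rw [heq]
    have hz : Tendsto (fun n : ℕ => ∫⁻ η, ((Ioc (-(2 ^ n) : ℝ) (2 ^ n))ᶜ).indicator
        (fun η => ‖F η‖ₑ ^ 2) η) atTop (𝓝 (∫⁻ _ : ℝ, 0)) := by
      have hFm : AEMeasurable (fun η => ‖F η‖ₑ ^ 2) volume :=
        ((Lp.aestronglyMeasurable F).enorm).pow_const 2
      refine tendsto_lintegral_of_dominated_convergence' (fun η => ‖F η‖ₑ ^ 2)
        (fun n => hFm.indicator (hm n).compl)
        (fun n => Eventually.of_forall fun η => indicator_le_self _ _ _) ?_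
        (Eventually.of_forall fun η => ?_)
      · have := (Lp.memLp F).2
        rw [eLpNorm_lt_top_iff_lintegral_rpow_enorm_lt_top (by norm_num) (by norm_num)] at this
        simpa using this.ne
      · refine tendsto_const_nhds.congr' ?_
        have : Tendsto (fun n : ℕ => (2 : ℝ) ^ n) atTop atTop :=
          tendsto_pow_atTop_atTop_of_one_lt (by norm_num)
        filter_upwards [this.eventually_gt_atTop |η|] with n hn
        rw [indicator_of_notMem]
        rw [notMem_compl_iff]
        exact ⟨(abs_lt.1 hn).1, (abs_lt.1 hn).2.le⟩
    rw [lintegral_zero] at hz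
    have := (ENNReal.continuous_rpow_const (y := 1 / 2)).tendsto 0 |>.comp hz
    simpa [Function.comp_def] using this
  have hlim2 : Tendsto (fun n => (𝓕⁻ ((hmem n).toLp _) : Lp ℂ 2 (volume : Measure ℝ))) atTop
      (𝓝 f) := by
    have h1 : 𝓕⁻ F = f := FourierTransform.fourierInv_fourier_eq f
    rw [← h1]
    exact ((Lp.fourierTransformₗᵢ ℝ ℂ).symm.continuous.tendsto F).comp hlim
  obtain ⟨ns, hns, hae⟩ := (tendstoInMeasure_of_tendsto_Lp hlim2).exists_seq_tendsto_ae
  refine ⟨ns, hns, ?_⟩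
  have hall : ∀ᵐ x : ℝ, ∀ n : ℕ, (𝓕⁻ ((hmem n).toLp _) : Lp ℂ 2 (volume : Measure ℝ)) x =
      𝓕⁻ ((Ioc (-(2 ^ n) : ℝ) (2 ^ n)).indicator F) x :=
    ae_all_iff.2 fun n => fourierInv_toLp_ae_eq (hint n) (hmem n)
  filter_upwards [hae, hall] with x hx hx2
  refine hx.congr fun i => ?_
  rw [hx2, schrodingerTrunc_eq_integral_quadExp, Real.fourierInv_eq',
    intervalIntegral.integral_of_le (by linarith [pow_pos (two_pos (α := ℝ)) (ns i)]),
    ← integral_indicator (hm _)]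
  refine integral_congr_ae (Eventually.of_forall fun η => ?_)
  by_cases h : η ∈ Ioc (-(2 ^ ns i) : ℝ) (2 ^ ns i)
  · simp only [indicator_of_mem h, smul_eq_mul, quadExp]
    congr 2
    simp
    ring
  · simp [indicator_of_notMem h]

end Fourier

/-! ### From maximal estimates to pointwise decay of dyadic blocks -/

section Dyadic

open scoped ENNReal ComplexConjugate

theorem ofReal_rpow_mul_lintegral_annulus_le {S : ℝ} (hS : 0 ≤ S) (F : ℝ → ℂ) {N : ℝ}
    (hN : 0 < N) :
    ENNReal.ofReal (N ^ (2 * S)) * ∫⁻ η, ‖F η‖ₑ ^ 2 ∂annulusMeasure N ≤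
      ∫⁻ η in freqAnnulus N (2 * N),
        ‖(((1 + ‖η‖ ^ 2) ^ (S / 2) : ℝ) : ℂ) * F η‖ₑ ^ 2 := by
  rw [annulusMeasure, ← lintegral_const_mul' _ _ ENNReal.ofReal_ne_top]
  refine setLIntegral_mono' (measurableSet_freqAnnulus _ _) fun η hη => ?_
  rw [enorm_mul, mul_pow]
  refine mul_le_mul_left ?_ _
  rw [← ofReal_norm, ← ENNReal.ofReal_pow (norm_nonneg _), Complex.norm_real,
    Real.norm_of_nonneg (by positivity), ← Real.rpow_mul_natCast (by positivity)]
  refine ENNReal.ofReal_le_ofReal ?_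
  have h1 : N ^ 2 ≤ 1 + ‖η‖ ^ 2 := by
    have : N ≤ ‖η‖ := hη.1.le
    nlinarith
  calc N ^ (2 * S) = (N ^ 2) ^ S := by
        rw [← Real.rpow_natCast N 2, ← Real.rpow_mul hN.le]; norm_num
    _ ≤ (1 + ‖η‖ ^ 2) ^ S := Real.rpow_le_rpow (by positivity) h1 hS
    _ = _ := by congr 1; push_cast; ring

/-- Dyadic pieces whose maximal functions lose `σ` derivatives decay pointwise almost everywhere
at the rate given by the remaining regularity. -/
theorem ae_exists_forall_le_of_lintegral_le {X : Type*} [MeasurableSpace X] {μ : Measure X}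
    {S σ β : ℝ} (hS : 0 ≤ S) (hβ : σ + β = S) {F : ℝ → ℂ}
    (hF : MemLp (fun η : ℝ => (((1 + ‖η‖ ^ 2) ^ (S / 2) : ℝ) : ℂ) * F η) 2)
    {Φ : ℕ → X → ℝ≥0∞} (hΦ : ∀ k, AEMeasurable (Φ k) μ) {C : ℝ≥0∞} (hC : C ≠ ∞)
    (hle : ∀ k, ∫⁻ x, Φ k x ∂μ ≤ C * ENNReal.ofReal (((2 : ℝ) ^ k) ^ (2 * σ)) *
      ∫⁻ η, ‖F η‖ₑ ^ 2 ∂annulusMeasure (2 ^ k)) :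
    ∀ᵐ x ∂μ, ∃ D : ℝ, 0 ≤ D ∧ ∀ k, Φ k x ≤ ENNReal.ofReal (D * ((2 : ℝ) ^ k) ^ (-(2 * β))) := by
  set H : ℝ → ℝ≥0∞ := fun η => ‖(((1 + ‖η‖ ^ 2) ^ (S / 2) : ℝ) : ℂ) * F η‖ₑ ^ 2 with hH
  have hHfin : ∫⁻ η, H η ≠ ∞ := by
    have := hF.2
    rw [eLpNorm_lt_top_iff_lintegral_rpow_enorm_lt_top (by norm_num) (by norm_num)] at this
    simpa [hH] using this.ne
  have hdisj : Pairwise (Function.onFun Disjoint fun k : ℕ =>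
      freqAnnulus ((2 : ℝ) ^ k) (2 * 2 ^ k)) := by
    intro i j hij
    wlog hlt : i < j generalizing i j
    · exact (this hij.symm (lt_of_le_of_ne (not_lt.1 hlt) hij.symm)).symm
    rw [Function.onFun, disjoint_left]
    intro η h1 h2
    have h3 : (2 : ℝ) * 2 ^ i ≤ 2 ^ j := by
      rw [← pow_succ']; exact pow_le_pow_right₀ (by norm_num) hlt
    exact absurd (h1.2.trans h3) (not_le.2 h2.1)
  have hterm : ∀ k, ENNReal.ofReal (((2 : ℝ) ^ k) ^ (2 * β)) * ∫⁻ x, Φ k x ∂μ ≤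
      C * ∫⁻ η in freqAnnulus ((2 : ℝ) ^ k) (2 * 2 ^ k), H η := fun k => by
    have h2 : (0 : ℝ) < 2 ^ k := by positivity
    calc _ ≤ ENNReal.ofReal (((2 : ℝ) ^ k) ^ (2 * β)) * (C *
          ENNReal.ofReal (((2 : ℝ) ^ k) ^ (2 * σ)) *
          ∫⁻ η, ‖F η‖ₑ ^ 2 ∂annulusMeasure (2 ^ k)) := mul_le_mul_right (hle k) _
      _ = C * ((ENNReal.ofReal (((2 : ℝ) ^ k) ^ (2 * σ)) *
          ENNReal.ofReal (((2 : ℝ) ^ k) ^ (2 * β))) *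
          ∫⁻ η, ‖F η‖ₑ ^ 2 ∂annulusMeasure (2 ^ k)) := by ring
      _ = C * (ENNReal.ofReal (((2 : ℝ) ^ k) ^ (2 * S)) *
          ∫⁻ η, ‖F η‖ₑ ^ 2 ∂annulusMeasure (2 ^ k)) := by
        rw [← ENNReal.ofReal_mul (by positivity), ← Real.rpow_add h2, ← mul_add, hβ]
      _ ≤ _ := mul_le_mul_right (ofReal_rpow_mul_lintegral_annulus_le hS F h2) _
  -- The annuli are disjoint, so the weighted sum of all blocks has finite integral; where it is
  -- finite, it bounds each of its terms, and its value provides D.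
  set Ψ : X → ℝ≥0∞ := fun x => ∑' k, ENNReal.ofReal (((2 : ℝ) ^ k) ^ (2 * β)) * Φ k x with hΨ
  have hm : ∀ k, AEMeasurable (fun x => ENNReal.ofReal (((2 : ℝ) ^ k) ^ (2 * β)) * Φ k x) μ :=
    fun k => (hΦ k).const_mul _
  have hfin : ∫⁻ x, Ψ x ∂μ ≠ ∞ := by
    rw [hΨ, lintegral_tsum hm]
    refine ne_top_of_le_ne_top (ENNReal.mul_ne_top hC hHfin) ?_
    calc ∑' k, ∫⁻ x, ENNReal.ofReal (((2 : ℝ) ^ k) ^ (2 * β)) * Φ k x ∂μ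
        ≤ ∑' k, C * ∫⁻ η in freqAnnulus ((2 : ℝ) ^ k) (2 * 2 ^ k), H η := by
          refine ENNReal.tsum_le_tsum fun k => ?_
          rw [lintegral_const_mul' _ _ ENNReal.ofReal_ne_top]
          exact hterm k
      _ = C * ∑' k, ∫⁻ η in freqAnnulus ((2 : ℝ) ^ k) (2 * 2 ^ k), H η := ENNReal.tsum_mul_left
      _ = C * ∫⁻ η in ⋃ k : ℕ, freqAnnulus ((2 : ℝ) ^ k) (2 * 2 ^ k), H η := by
          rw [lintegral_iUnion (fun k => measurableSet_freqAnnulus _ _) hdisj]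
      _ ≤ C * ∫⁻ η, H η := mul_le_mul_right (setLIntegral_le_lintegral _ _) _
  have hΨm : AEMeasurable Ψ μ := AEMeasurable.tsum hm
  filter_upwards [ae_lt_top' hΨm hfin] with x hx
  refine ⟨(Ψ x).toReal, ENNReal.toReal_nonneg, fun k => ?_⟩
  have h2 : (0 : ℝ) < 2 ^ k := by positivity
  have h1 : ENNReal.ofReal (((2 : ℝ) ^ k) ^ (2 * β)) * Φ k x ≤ Ψ x :=
    ENNReal.le_tsum (f := fun k : ℕ => ENNReal.ofReal (((2 : ℝ) ^ k) ^ (2 * β)) * Φ k x) k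
  rw [ENNReal.ofReal_mul ENNReal.toReal_nonneg, ENNReal.ofReal_toReal hx.ne,
    Real.rpow_neg h2.le, ENNReal.ofReal_inv_of_pos (by positivity), ← div_eq_mul_inv,
    ENNReal.le_div_iff_mul_le (Or.inl (by positivity)) (Or.inl ENNReal.ofReal_ne_top), mul_comm]
  exact h1

theorem norm_le_of_iSup_enorm_sq_le {P : Type*} {u : P → ℂ} {D N β : ℝ} (hD : 0 ≤ D) (hN : 0 < N)
    (h : ⨆ p, ‖u p‖ₑ ^ 2 ≤ ENNReal.ofReal (D * N ^ (-(2 * β)))) (p : P) :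
    ‖u p‖ ≤ √D * N ^ (-β) := by
  have h1 := (le_iSup (fun p => ‖u p‖ₑ ^ 2) p).trans h
  rw [← ofReal_norm, ← ENNReal.ofReal_pow (norm_nonneg _),
    ENNReal.ofReal_le_ofReal_iff (by positivity)] at h1
  refine le_of_sq_le_sq (h1.trans (le_of_eq ?_)) (by positivity)
  rw [mul_pow, Real.sq_sqrt hD, ← Real.rpow_mul_natCast hN.le]
  congr 2
  push_cast
  ring

theorem integral_cutExp_mul_annulusMeasure {N ρ : ℝ} (hρ : ρ ≤ 2 * N) (A τ : ℝ) (g : ℝ → ℂ) :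
    ∫ η, cutExp ρ A τ η * g η ∂annulusMeasure N =
      ∫ η in freqAnnulus N ρ, quadExp A τ η * g η := by
  have hm : MeasurableSet {η : ℝ | |η| ≤ ρ} := measurableSet_le measurable_norm measurable_const
  have h : ∀ η, cutExp ρ A τ η * g η =
      {η : ℝ | |η| ≤ ρ}.indicator (fun η => quadExp A τ η * g η) η := fun η => by
    by_cases hη : η ∈ {η : ℝ | |η| ≤ ρ}
    · rw [cutExp, indicator_of_mem hη, indicator_of_mem hη]
    · rw [cutExp, indicator_of_notMem hη, indicator_of_notMem hη, zero_mul]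
  simp_rw [h]
  rw [integral_indicator hm, annulusMeasure, Measure.restrict_restrict hm]
  congr 2
  ext η
  simp only [freqAnnulus, mem_inter_iff, mem_ofPred_eq]
  constructor
  · exact fun h => ⟨h.2.1, h.1⟩
  · exact fun h => ⟨h.2, h.1, h.2.trans hρ⟩

theorem integrableOn_quadExp_mul {F : ℝ → ℂ} (hF : MemLp F 2) (A τ R : ℝ) :
    IntegrableOn (fun η => quadExp A τ η * F η) (Icc (-R) R) := by
  have hi : IntegrableOn F (Icc (-R) R) := (hF.restrict _).integrable (by norm_num)
  refine hi.bdd_mul (c := 1) (continuous_quadExp A τ).aestronglyMeasurable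
    (Eventually.of_forall fun η => (norm_quadExp A τ η).le)

theorem schrodingerTrunc_eq_setIntegral (f : Lp ℂ 2 (volume : Measure ℝ)) (t y : ℝ) {R : ℝ}
    (hR : 0 ≤ R) :
    schrodingerTrunc f t y R = ∫ η in Icc (-R) R,
      quadExp (2 * Real.pi * y) (4 * Real.pi ^ 2 * t) η *
        (𝓕 f : Lp ℂ 2 (volume : Measure ℝ)) η := by
  rw [schrodingerTrunc_eq_integral_quadExp, intervalIntegral.integral_of_le (by linarith),
    integral_Icc_eq_integral_Ioc]

/-- Expresses the oscillation of the improper integral within one dyadic scale as the quantity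
controlled by the maximal estimates, with R as cutoff parameter. -/
theorem schrodingerTrunc_sub (f : Lp ℂ 2 (volume : Measure ℝ)) (t y : ℝ) {N R : ℝ}
    (hN : 0 ≤ N) (hNR : N ≤ R) (hR : R ≤ 2 * N) :
    schrodingerTrunc f t y R - schrodingerTrunc f t y N =
      ∫ η, cutExp R (2 * Real.pi * y) (4 * Real.pi ^ 2 * t) η *
        (𝓕 f : Lp ℂ 2 (volume : Measure ℝ)) η ∂annulusMeasure N := by
  rw [schrodingerTrunc_eq_setIntegral f t y hN, schrodingerTrunc_eq_setIntegral f t y (hN.trans hNR),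
    integral_cutExp_mul_annulusMeasure hR, ← setIntegral_sdiff measurableSet_Icc
      (integrableOn_quadExp_mul (Lp.memLp _) _ _ R) (Icc_subset_Icc (by linarith) hNR)]
  congr 2
  ext η
  simp only [freqAnnulus, Set.mem_sdiff, mem_ofPred_eq, ← abs_le, not_le, mem_Icc]
  exact and_comm

theorem norm_quadExp_sub_le (A τ A' τ' η : ℝ) :
    ‖quadExp A τ η - quadExp A' τ' η‖ ≤ |A - A'| * |η| + |τ - τ'| * |η| ^ 2 := by
  have h : quadExp A τ η - quadExp A' τ' η =
      quadExp A' τ' η * (Complex.exp (Complex.I * ((A - A') * η + (τ - τ') * η ^ 2 : ℝ)) - 1) := by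
    rw [mul_sub, mul_one, quadExp, quadExp, ← Complex.exp_add]
    congr 2
    push_cast
    ring
  rw [h, norm_mul, norm_quadExp, one_mul]
  refine Real.norm_exp_I_mul_ofReal_sub_one_le.trans ?_
  rw [Real.norm_eq_abs]
  refine (abs_add_le _ _).trans ?_
  rw [abs_mul, abs_mul, abs_pow]

/-- The constant may grow with R: the bound serves only to make each fixed frequency range
negligible as t → 0. -/
theorem exists_norm_schrodingerTrunc_sub_le (f : Lp ℂ 2 (volume : Measure ℝ)) {R : ℝ}
    (hR : 0 ≤ R) :
    ∃ C : ℝ, 0 ≤ C ∧ ∀ t x y : ℝ,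
      ‖schrodingerTrunc f t y R - schrodingerTrunc f 0 x R‖ ≤ C * (|y - x| + |t|) := by
  set F : Lp ℂ 2 (volume : Measure ℝ) := 𝓕 f
  have hi : IntegrableOn F (Icc (-R) R) := ((Lp.memLp F).restrict _).integrable (by norm_num)
  set I := ∫ η in Icc (-R) R, ‖F η‖
  have hI : 0 ≤ I := integral_nonneg fun _ => norm_nonneg _
  refine ⟨(2 * Real.pi * R + 4 * Real.pi ^ 2 * R ^ 2) * I, by positivity, fun t x y => ?_⟩
  rw [schrodingerTrunc_eq_setIntegral f t y hR, schrodingerTrunc_eq_setIntegral f 0 x hR,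
    ← integral_sub (integrableOn_quadExp_mul (Lp.memLp _) _ _ R)
      (integrableOn_quadExp_mul (Lp.memLp _) _ _ R)]
  have hb : ∀ᵐ η ∂volume.restrict (Icc (-R) R),
      ‖quadExp (2 * Real.pi * y) (4 * Real.pi ^ 2 * t) η * F η -
        quadExp (2 * Real.pi * x) (4 * Real.pi ^ 2 * 0) η * F η‖ ≤
      (2 * Real.pi * R + 4 * Real.pi ^ 2 * R ^ 2) * (|y - x| + |t|) * ‖F η‖ := by
    filter_upwards [ae_restrict_mem measurableSet_Icc] with η hη
    rw [← sub_mul, norm_mul]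
    refine mul_le_mul_of_nonneg_right ?_ (norm_nonneg _)
    have hη' : |η| ≤ R := abs_le.2 hη
    refine (norm_quadExp_sub_le _ _ _ _ _).trans ?_
    rw [← mul_sub, ← mul_sub, abs_mul (2 * Real.pi), abs_mul (4 * Real.pi ^ 2),
      abs_of_pos Real.two_pi_pos,
      abs_of_pos (by positivity : 0 < 4 * Real.pi ^ 2), sub_zero]
    have h2 : |η| ^ 2 ≤ R ^ 2 := pow_le_pow_left₀ (abs_nonneg _) hη' 2
    calc 2 * Real.pi * |y - x| * |η| + 4 * Real.pi ^ 2 * |t| * |η| ^ 2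
        ≤ 2 * Real.pi * |y - x| * R + 4 * Real.pi ^ 2 * |t| * R ^ 2 := by gcongr
      _ ≤ _ := by
        have h3 : 0 ≤ 2 * Real.pi * |t| * R := by positivity
        have h4 : 0 ≤ 4 * Real.pi ^ 2 * |y - x| * R ^ 2 := by positivity
        nlinarith
  refine (norm_integral_le_of_norm_le (hi.norm.const_mul _) hb).trans (le_of_eq ?_)
  rw [integral_const_mul]
  ring

/-- Mean value estimate, in the space-time variables, for a frequency-localized evolution. -/
theorem norm_integral_quadExp_sub_le {N : ℝ} (hN : 0 < N) {F : ℝ → ℂ}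
    (hF : Integrable F (annulusMeasure N)) {x z t M : ℝ}
    (h1 : ∀ u ∈ Icc (0 : ℝ) 1, ‖∫ η, quadExp (2 * Real.pi * (x + u * z))
      (4 * Real.pi ^ 2 * (u * t)) η * (((η / N : ℝ) : ℂ) * F η) ∂annulusMeasure N‖ ≤ M)
    (h2 : ∀ u ∈ Icc (0 : ℝ) 1, ‖∫ η, quadExp (2 * Real.pi * (x + u * z))
      (4 * Real.pi ^ 2 * (u * t)) η * ((((η / N) ^ 2 : ℝ) : ℂ) * F η) ∂annulusMeasure N‖ ≤ M) :
    ‖(∫ η, quadExp (2 * Real.pi * (x + z)) (4 * Real.pi ^ 2 * t) η * F η ∂annulusMeasure N) -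
      ∫ η, quadExp (2 * Real.pi * x) 0 η * F η ∂annulusMeasure N‖ ≤
      (2 * Real.pi * N * |z| + 4 * Real.pi ^ 2 * N ^ 2 * |t|) * M := by
  set ν := annulusMeasure N
  -- The segment u ↦ (x + uz, ut) joins the two evaluation points. Differentiating in u brings down
  -- η and η², normalized to η/N and (η/N)², which are bounded by 2 and 4 on the annulus.
  set q : ℝ → ℝ → ℂ := fun u η => quadExp (2 * Real.pi * (x + u * z))
    (4 * Real.pi ^ 2 * (u * t)) η with hq
  have hηN : ∀ᵐ η ∂ν, |η / N| ≤ 2 := by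
    filter_upwards [ae_restrict_mem (measurableSet_freqAnnulus N (2 * N))] with η hη
    rw [abs_div, abs_of_pos hN, div_le_iff₀ hN]
    exact hη.2
  have hmul : ∀ (u : ℝ) (n : ℕ), Integrable (fun η => q u η * ((((η / N) ^ n : ℝ) : ℂ) * F η)) ν := by
    intro u n
    refine (hF.bdd_mul (c := 2 ^ n) ?_ ?_).bdd_mul (c := 1)
      (continuous_quadExp _ _).aestronglyMeasurable
      (Eventually.of_forall fun η => (norm_quadExp _ _ η).le)
    · exact Continuous.aestronglyMeasurable (by fun_prop)
    · filter_upwards [hηN] with η hη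
      rw [Complex.norm_real, Real.norm_eq_abs, abs_pow]
      exact pow_le_pow_left₀ (abs_nonneg _) hη n
  have hq0 : ∀ u, Integrable (fun η => q u η * F η) ν := fun u => by simpa using hmul u 0
  set c₁ : ℂ := Complex.I * (2 * Real.pi * N * z : ℝ)
  set c₂ : ℂ := Complex.I * (4 * Real.pi ^ 2 * N ^ 2 * t : ℝ)
  set q' : ℝ → ℝ → ℂ := fun u η => c₁ * (q u η * ((((η / N) ^ 1 : ℝ) : ℂ) * F η)) +
    c₂ * (q u η * ((((η / N) ^ 2 : ℝ) : ℂ) * F η)) with hq'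
  have hderivq : ∀ η u, HasDerivAt (fun u => q u η * F η) (q' u η) u := by
    intro η u
    have hlin : HasDerivAt (fun u : ℝ => 2 * Real.pi * (x + u * z) * η +
        4 * Real.pi ^ 2 * (u * t) * η ^ 2) (2 * Real.pi * z * η + 4 * Real.pi ^ 2 * t * η ^ 2) u := by
      have e : (fun u : ℝ => 2 * Real.pi * (x + u * z) * η + 4 * Real.pi ^ 2 * (u * t) * η ^ 2) =
          fun u : ℝ => 2 * Real.pi * x * η +
            (2 * Real.pi * z * η + 4 * Real.pi ^ 2 * t * η ^ 2) * u := by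
        ext u; ring
      rw [e]
      simpa using ((hasDerivAt_id u).const_mul
        (2 * Real.pi * z * η + 4 * Real.pi ^ 2 * t * η ^ 2)).const_add (2 * Real.pi * x * η)
    refine (((hlin.ofReal_comp.const_mul Complex.I).cexp).mul_const (F η)).congr_deriv ?_
    have hNC : (N : ℂ) ≠ 0 := Complex.ofReal_ne_zero.2 hN.ne'
    simp only [hq', hq, quadExp, c₁, c₂]
    push_cast
    field_simp
  have hderiv : ∀ u, HasDerivAt (fun u => ∫ η, q u η * F η ∂ν) (∫ η, q' u η ∂ν) u := by
    intro u
    refine (hasDerivAt_integral_of_dominated_loc_of_deriv_le (s := univ)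
      (bound := fun η => (‖c₁‖ * 2 + ‖c₂‖ * 4) * ‖F η‖) univ_mem
      (Eventually.of_forall fun u => (hq0 u).1) (hq0 u) ?_ ?_ (hF.norm.const_mul _)
      (Eventually.of_forall fun η u _ => hderivq η u)).2
    · exact (((hmul u 1).const_mul _).add ((hmul u 2).const_mul _)).1
    · filter_upwards [hηN] with η hη u _
      have hb : ∀ n : ℕ, ‖q u η * ((((η / N) ^ n : ℝ) : ℂ) * F η)‖ ≤ 2 ^ n * ‖F η‖ := fun n => by
        rw [norm_mul, hq, norm_quadExp, one_mul, norm_mul, Complex.norm_real, Real.norm_eq_abs,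
          abs_pow]
        gcongr
      refine (norm_add_le _ _).trans ?_
      rw [norm_mul, norm_mul c₂]
      calc _ ≤ ‖c₁‖ * (2 ^ 1 * ‖F η‖) + ‖c₂‖ * (2 ^ 2 * ‖F η‖) := by
            gcongr
            · exact hb 1
            · exact hb 2
        _ = _ := by ring
  have hfinal := norm_image_sub_le_of_norm_deriv_le_segment_01'
    (f := fun u => ∫ η, q u η * F η ∂ν) (f' := fun u => ∫ η, q' u η ∂ν)
    (C := (2 * Real.pi * N * |z| + 4 * Real.pi ^ 2 * N ^ 2 * |t|) * M)
    (fun u _ => (hderiv u).hasDerivWithinAt) fun u hu => ?_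
  · simpa [hq] using hfinal
  · have hu' : u ∈ Icc (0 : ℝ) 1 := ⟨hu.1, hu.2.le⟩
    rw [hq', integral_add ((hmul u 1).const_mul _) ((hmul u 2).const_mul _), integral_const_mul,
      integral_const_mul]
    refine (norm_add_le _ _).trans ?_
    rw [norm_mul c₁, norm_mul c₂, add_mul]
    have e1 : ‖c₁‖ = 2 * Real.pi * N * |z| := by
      simp only [c₁]
      rw [norm_mul, Complex.norm_I, one_mul, Complex.norm_real, Real.norm_eq_abs, abs_mul,
        abs_of_pos (by positivity)]
    have e2 : ‖c₂‖ = 4 * Real.pi ^ 2 * N ^ 2 * |t| := by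
      simp only [c₂]
      rw [norm_mul, Complex.norm_I, one_mul, Complex.norm_real, Real.norm_eq_abs, abs_mul,
        abs_of_pos (by positivity)]
    rw [e1, e2]
    gcongr
    · simpa only [pow_one] using h1 u hu'
    · exact h2 u hu'

end Dyadic

/-! ### Summation of the dyadic blocks at a fixed point -/

section Deterministic

theorem summable_two_pow_rpow_neg {ε : ℝ} (hε : 0 < ε) :
    Summable fun k : ℕ => ((2 : ℝ) ^ k) ^ (-ε) := by
  have h : ∀ k : ℕ, ((2 : ℝ) ^ k) ^ (-ε) = ((2 : ℝ) ^ (-ε)) ^ k := fun k => by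
    rw [← Real.rpow_natCast, ← Real.rpow_natCast, ← Real.rpow_mul (by norm_num),
      ← Real.rpow_mul (by norm_num), mul_comm]
  simp_rw [h]
  exact summable_geometric_of_lt_one (by positivity)
    (Real.rpow_lt_one_of_one_lt_of_neg (by norm_num) (by linarith))

/-- Convergence at infinity of a function whose oscillation on dyadic intervals is geometrically
small. -/
theorem tendsto_add_tsum_of_dyadic {S : ℝ → ℂ} {D β : ℝ} (hβ : 0 < β)
    (h : ∀ (k : ℕ), ∀ R ∈ Icc ((2 : ℝ) ^ k) (2 * 2 ^ k), ‖S R - S (2 ^ k)‖ ≤ D * (2 ^ k : ℝ) ^ (-β)) :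
    Tendsto S atTop (𝓝 (S 1 + ∑' k : ℕ, (S (2 * 2 ^ k) - S (2 ^ k)))) := by
  set L := S 1 + ∑' k : ℕ, (S (2 * 2 ^ k) - S (2 ^ k)) with hL
  have hsum : Summable fun k : ℕ => S (2 * 2 ^ k) - S (2 ^ k) :=
    Summable.of_norm_bounded ((summable_two_pow_rpow_neg hβ).mul_left D) fun k =>
      h k _ ⟨by linarith [pow_pos (two_pos (α := ℝ)) k], le_rfl⟩
  have hseq : Tendsto (fun K : ℕ => S (2 ^ K)) atTop (𝓝 L) := by
    have h1 := (hsum.hasSum.tendsto_sum_nat).const_add (S 1)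
    refine h1.congr fun K => ?_
    have h2 := Finset.sum_range_sub (fun k : ℕ => S (2 ^ k)) K
    simp only [pow_succ'] at h2
    rw [h2]
    simp
  have hz : Tendsto (fun k : ℕ => D * ((2 : ℝ) ^ k) ^ (-β)) atTop (𝓝 0) := by
    simpa using (summable_two_pow_rpow_neg hβ).tendsto_atTop_zero.const_mul D
  rw [Metric.tendsto_atTop]
  intro e he
  obtain ⟨K₁, hK₁⟩ := Metric.tendsto_atTop.1 hseq (e / 2) (by positivity)
  obtain ⟨K₂, hK₂⟩ := Metric.tendsto_atTop.1 hz (e / 2) (by positivity)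
  refine ⟨2 ^ max K₁ K₂, fun R hR => ?_⟩
  have hR1 : 1 ≤ R := (one_le_pow₀ (by norm_num)).trans hR
  obtain ⟨k, hk1, hk2⟩ := exists_nat_pow_near hR1 (one_lt_two (α := ℝ))
  have hk : max K₁ K₂ ≤ k := by
    by_contra hlt
    have : (2 : ℝ) ^ (k + 1) ≤ 2 ^ max K₁ K₂ :=
      pow_le_pow_right₀ (by norm_num) (by omega)
    linarith
  have a1 := hK₁ k ((le_max_left _ _).trans hk)
  have a2 := hK₂ k ((le_max_right _ _).trans hk)
  have a3 := h k R ⟨hk1, by rw [← pow_succ']; exact hk2.le⟩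
  rw [Real.dist_eq, sub_zero] at a2
  have a4 := le_abs_self (D * ((2 : ℝ) ^ k) ^ (-β))
  calc dist (S R) L ≤ dist (S R) (S (2 ^ k)) + dist (S (2 ^ k)) L := dist_triangle _ _ _
    _ < e := by rw [dist_eq_norm (S R)]; linarith

/-- Passage from dyadic bounds to a rate of convergence as `t → 0⁺`. -/
theorem exists_tendsto_and_isLittleO_of_dyadic {S : ℝ → ℝ → ℂ} {D β δ ε h α m T : ℝ}
    (hT : 0 < T) (hD : 0 ≤ D) (hε : 0 < ε) (hδ : 0 ≤ δ) (hβ : β = δ + ε) (hh : 0 ≤ h)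
    (hhα : h < α) (hα : α < 1) (hm : h * m ≤ δ)
    (h1 : ∀ (k : ℕ), ∀ t ∈ Icc 0 T, ∀ R ∈ Icc ((2 : ℝ) ^ k) (2 * 2 ^ k),
      ‖S t R - S t (2 ^ k)‖ ≤ D * (2 ^ k : ℝ) ^ (-β))
    (h2 : ∀ (k : ℕ), ∀ t ∈ Ioc 0 T, t ≤ (2 ^ k : ℝ) ^ (-m) →
      ‖(S t (2 * 2 ^ k) - S t (2 ^ k)) - (S 0 (2 * 2 ^ k) - S 0 (2 ^ k))‖ ≤
        D * (2 ^ k : ℝ) ^ (-ε) * t ^ h)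
    (h3 : ∀ R : ℝ, 0 ≤ R → ∃ C : ℝ, 0 ≤ C ∧ ∀ t ∈ Icc 0 T, ‖S t R - S 0 R‖ ≤ C * (t ^ α + t)) :
    ∃ L : ℝ → ℂ, (∀ t ∈ Icc 0 T, Tendsto (S t) atTop (𝓝 (L t))) ∧
      (fun t => L t - L 0) =o[𝓝[>] (0 : ℝ)] fun t => t ^ h := by
  have hβ0 : 0 < β := by linarith
  set d : ℕ → ℝ → ℂ := fun k t => S t (2 * 2 ^ k) - S t (2 ^ k) with hd
  have hdb : ∀ k, ∀ t ∈ Icc 0 T, ‖d k t‖ ≤ D * (2 ^ k : ℝ) ^ (-β) := fun k t ht =>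
    h1 k t ht _ ⟨by linarith [pow_pos (two_pos (α := ℝ)) k], le_rfl⟩
  refine ⟨fun t => S t 1 + ∑' k, d k t, fun t ht =>
    tendsto_add_tsum_of_dyadic hβ0 fun k => h1 k t ht, ?_⟩
  have h0T : (0 : ℝ) ∈ Icc 0 T := left_mem_Icc.2 hT.le
  have hnear : ∀ᶠ t in 𝓝[>] (0 : ℝ), t ∈ Ioc 0 T := Ioc_mem_nhdsGT hT
  have hsum : ∀ t ∈ Icc 0 T, Summable fun k => d k t := fun t ht =>
    Summable.of_norm_bounded ((summable_two_pow_rpow_neg hβ0).mul_left D) fun k => hdb k t ht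
  have hlim : Tendsto (fun t : ℝ => t ^ (α - h) + t ^ (1 - h)) (𝓝[>] 0) (𝓝 0) := by
    have e : ∀ a : ℝ, 0 < a → Tendsto (fun t : ℝ => t ^ a) (𝓝[>] 0) (𝓝 0) := fun a ha => by
      have := (Real.continuous_rpow_const ha.le).tendsto 0
      rw [Real.zero_rpow ha.ne'] at this
      exact this.mono_left nhdsWithin_le_nhds
    simpa using (e (α - h) (by linarith)).add (e (1 - h) (by linarith))
  -- At fixed R the variation is O(t^α + t), so the strict inequality h < α makes it o(t^h).
  have hS : ∀ R : ℝ, 0 ≤ R →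
      Tendsto (fun t : ℝ => ((t ^ (-h) : ℝ) : ℂ) * (S t R - S 0 R)) (𝓝[>] 0) (𝓝 0) := by
    intro R hR
    obtain ⟨C, hC0, hC⟩ := h3 R hR
    refine squeeze_zero_norm' (a := fun t => C * (t ^ (α - h) + t ^ (1 - h))) ?_
      (by simpa using hlim.const_mul C)
    filter_upwards [hnear] with t ht
    rw [norm_mul, Complex.norm_real, Real.norm_of_nonneg (Real.rpow_nonneg ht.1.le _)]
    calc t ^ (-h) * ‖S t R - S 0 R‖ ≤ t ^ (-h) * (C * (t ^ α + t)) :=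
          mul_le_mul_of_nonneg_left (hC t ⟨ht.1.le, ht.2⟩) (Real.rpow_nonneg ht.1.le _)
      _ = _ := by
        rw [sub_eq_add_neg, sub_eq_add_neg, Real.rpow_add ht.1, Real.rpow_add ht.1, Real.rpow_one]
        ring
  have hbound : ∀ᶠ t in 𝓝[>] (0 : ℝ), ∀ k, ‖((t ^ (-h) : ℝ) : ℂ) * (d k t - d k 0)‖ ≤
      2 * D * (2 ^ k : ℝ) ^ (-ε) := by
    filter_upwards [hnear] with t ht k
    have h2k : (0 : ℝ) < 2 ^ k := by positivity
    have hth : 0 < t ^ h := Real.rpow_pos_of_pos ht.1 _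
    rw [norm_mul, Complex.norm_real, Real.norm_of_nonneg (Real.rpow_nonneg ht.1.le _),
      Real.rpow_neg ht.1.le, inv_mul_le_iff₀ hth]
    -- For small t the mean value bound applies; for larger t, hm ≤ δ gives t^h ≥ 2^(-kδ), so the
    -- size bound leaves the summable factor 2^(-kε).
    rcases le_total t ((2 ^ k : ℝ) ^ (-m)) with hc | hc
    · refine (h2 k t ht hc).trans ?_
      have : 0 ≤ D * (2 ^ k : ℝ) ^ (-ε) * t ^ h := by positivity
      linarith
    · have hlow : (2 ^ k : ℝ) ^ (-δ) ≤ t ^ h := by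
        calc (2 ^ k : ℝ) ^ (-δ) ≤ (2 ^ k : ℝ) ^ (-(h * m)) :=
              Real.rpow_le_rpow_of_exponent_le (one_le_pow₀ (by norm_num)) (by linarith)
          _ = ((2 ^ k : ℝ) ^ (-m)) ^ h := by
            rw [← Real.rpow_mul h2k.le]; congr 1; ring
          _ ≤ t ^ h := Real.rpow_le_rpow (by positivity) hc hh
      have e1 : (2 ^ k : ℝ) ^ (-β) = (2 ^ k : ℝ) ^ (-δ) * (2 ^ k : ℝ) ^ (-ε) := by
        rw [← Real.rpow_add h2k, hβ]; congr 1; ring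
      have h5 := hdb k t ⟨ht.1.le, ht.2⟩
      have h6 := hdb k 0 h0T
      rw [e1] at h5 h6
      calc ‖d k t - d k 0‖ ≤ ‖d k t‖ + ‖d k 0‖ := norm_sub_le _ _
        _ ≤ (2 ^ k : ℝ) ^ (-δ) * (2 * D * (2 ^ k : ℝ) ^ (-ε)) := by linarith
        _ ≤ t ^ h * (2 * D * (2 ^ k : ℝ) ^ (-ε)) := by gcongr
  have htsum : Tendsto (fun t : ℝ => ∑' k, ((t ^ (-h) : ℝ) : ℂ) * (d k t - d k 0)) (𝓝[>] 0)
      (𝓝 (∑' _ : ℕ, (0 : ℂ))) := by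
    refine tendsto_tsum_of_dominated_convergence
      ((summable_two_pow_rpow_neg hε).mul_left (2 * D)) (fun k => ?_) hbound
    have := (hS (2 * 2 ^ k) (by positivity)).sub (hS (2 ^ k) (by positivity))
    rw [sub_zero] at this
    refine this.congr fun t => ?_
    simp only [hd]
    ring
  rw [tsum_zero] at htsum
  have htot := (hS 1 zero_le_one).add htsum
  rw [add_zero] at htot
  have hO : (fun t : ℝ => ((t ^ h : ℝ) : ℂ)) =O[𝓝[>] 0] fun t => t ^ h :=
    IsBigO.of_bound 1 (Eventually.of_forall fun t => by rw [Complex.norm_real, one_mul])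
  refine IsLittleO.trans_isBigO ?_ hO
  rw [isLittleO_iff_tendsto' (hnear.mono fun t ht h0 => by
    exact absurd (Complex.ofReal_eq_zero.1 h0) (Real.rpow_pos_of_pos ht.1 _).ne')]
  refine htot.congr' ?_
  filter_upwards [hnear] with t ht
  have ht' : t ∈ Icc 0 T := ⟨ht.1.le, ht.2⟩
  rw [tsum_mul_left, (hsum t ht').tsum_sub (hsum 0 h0T), Real.rpow_neg ht.1.le, Complex.ofReal_inv,
    div_eq_inv_mul]
  ring

end Deterministic

/-! ### Assembly of the almost everywhere bounds -/

section Assembly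

open scoped ENNReal

theorem ae_mem_ball_of_ae_ballMeasure {x₀ r : ℝ} {p : ℝ → Prop}
    (h : ∀ᵐ x : Metric.ball x₀ r ∂ballMeasure x₀ r, p x) : ∀ᵐ x : ℝ, x ∈ Metric.ball x₀ r → p x :=
  (ae_restrict_iff' Metric.isOpen_ball.measurableSet).1
    ((ae_restrict_iff_subtype Metric.isOpen_ball.measurableSet).2 h)

theorem integral_cutExp_two_mul_annulusMeasure (N A τ : ℝ) (g : ℝ → ℂ) :
    ∫ η, cutExp (2 * N) A τ η * g η ∂annulusMeasure N =
      ∫ η, quadExp A τ η * g η ∂annulusMeasure N := by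
  refine integral_congr_ae ?_
  filter_upwards [ae_restrict_mem (measurableSet_freqAnnulus N (2 * N))] with η hη
  rw [cutExp, indicator_of_mem (by exact hη.2)]

theorem ae_curve_bound {α x₀ r t₀ T σ β S : ℝ} {γ : ℝ → ℝ → ℝ} (hα : 0 < α)
    (h0 : (0 : ℝ) ∈ Ico (t₀ - T) (t₀ + T)) (hγ : IsBilipHolderCurve α x₀ r t₀ T γ)
    (hσ : 1 / 4 < σ) (hσ' : σ < 1 / 2) (hσα : 1 / 2 - α < σ) (hS : 0 ≤ S) (hβ : σ + β = S)
    {f : Lp ℂ 2 (volume : Measure ℝ)}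
    (hF : MemLp (fun η : ℝ => (((1 + ‖η‖ ^ 2) ^ (S / 2) : ℝ) : ℂ) *
      (𝓕 f : Lp ℂ 2 (volume : Measure ℝ)) η) 2) :
    ∀ᵐ x : ℝ, x ∈ Metric.ball x₀ r → ∃ D : ℝ, 0 ≤ D ∧ ∀ k : ℕ, ∀ t ∈ Icc 0 (t₀ + T),
      ∀ R ∈ Icc ((2 : ℝ) ^ k) (2 * 2 ^ k),
        ‖schrodingerTrunc f t (γ x t) R - schrodingerTrunc f t (γ x t) (2 ^ k)‖ ≤
          D * (2 ^ k : ℝ) ^ (-β) := by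
  obtain ⟨C, hC, hmax⟩ := exists_curve_maximal_bound hα h0 hγ hσ hσ' hσα
  have hmax' := fun k : ℕ => hmax (2 ^ k) (one_le_pow₀ (by norm_num))
    (𝓕 f : Lp ℂ 2 (volume : Measure ℝ)) ((Lp.memLp _).restrict _)
  refine ae_mem_ball_of_ae_ballMeasure ?_
  filter_upwards [ae_exists_forall_le_of_lintegral_le hS hβ hF (fun k => (hmax' k).1) hC
    (fun k => (hmax' k).2)] with x ⟨D, hD, hx⟩
  refine ⟨√D, Real.sqrt_nonneg _, fun k t ht R hR => ?_⟩
  have h2 : (0 : ℝ) < 2 ^ k := by positivity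
  rw [schrodingerTrunc_sub f t (γ x t) h2.le hR.1 hR.2]
  exact norm_le_of_iSup_enorm_sq_le hD h2 (hx k) (⟨t, ht⟩, ⟨R, hR⟩)

/-- The factor (η/N)^j is what the mean value estimate requires for j = 1, 2; it costs only the
constant 2^j. The loss N^(1/2) of the squared maximal estimate is absorbed by N^(2σ). -/
theorem ae_perturbation_bound (x₀ r : ℝ) {T c σ β S : ℝ} (hT : 0 ≤ T) (hc : 0 ≤ c)
    (hσ : 1 / 4 < σ) (hS : 0 ≤ S) (hβ : σ + β = S) (j : ℕ) {F : ℝ → ℂ} (hF2 : MemLp F 2)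
    (hF : MemLp (fun η : ℝ => (((1 + ‖η‖ ^ 2) ^ (S / 2) : ℝ) : ℂ) * F η) 2) :
    ∀ᵐ x : ℝ, x ∈ Metric.ball x₀ r → ∃ D : ℝ, 0 ≤ D ∧ ∀ k : ℕ,
      ∀ z ∈ Icc (-(c / 2 ^ k)) (c / 2 ^ k), ∀ t ∈ Icc 0 T,
        ‖∫ η, quadExp (2 * Real.pi * (x + z)) (4 * Real.pi ^ 2 * t) η *
          ((((η / 2 ^ k) ^ j : ℝ) : ℂ) * F η) ∂annulusMeasure (2 ^ k)‖ ≤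
          D * (2 ^ k : ℝ) ^ (-β) := by
  obtain ⟨C, hC, hmax⟩ := exists_perturbation_maximal_bound x₀ r T hT hc
  set g : ℕ → ℝ → ℂ := fun k η => (((η / 2 ^ k) ^ j : ℝ) : ℂ) * F η with hg
  have hgle : ∀ k : ℕ, ∀ᵐ η ∂annulusMeasure (2 ^ k), ‖g k η‖ ≤ 2 ^ j * ‖F η‖ := fun k => by
    filter_upwards [ae_restrict_mem (measurableSet_freqAnnulus (2 ^ k) (2 * 2 ^ k))] with η hη
    rw [hg, norm_mul, Complex.norm_real, Real.norm_eq_abs, abs_pow]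
    gcongr
    rw [abs_div, abs_of_pos (by positivity : (0 : ℝ) < 2 ^ k), div_le_iff₀ (by positivity)]
    exact hη.2
  have hFk : ∀ k : ℕ, MemLp F 2 (annulusMeasure (2 ^ k)) := fun k => hF2.restrict _
  have hgL : ∀ k : ℕ, MemLp (g k) 2 (annulusMeasure (2 ^ k)) := fun k =>
    (hFk k).of_le_mul ((Continuous.aestronglyMeasurable (by fun_prop)).mul (hFk k).1) (hgle k)
  have hmax' := fun k : ℕ => hmax (2 ^ k) (one_le_pow₀ (by norm_num)) (g k) (hgL k)
  have hle : ∀ k : ℕ, C * ENNReal.ofReal (((2 : ℝ) ^ k) ^ (1 / 2 : ℝ)) *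
      ∫⁻ η, ‖g k η‖ₑ ^ 2 ∂annulusMeasure (2 ^ k) ≤
      C * ENNReal.ofReal ((2 ^ j) ^ 2) * ENNReal.ofReal (((2 : ℝ) ^ k) ^ (2 * σ)) *
        ∫⁻ η, ‖F η‖ₑ ^ 2 ∂annulusMeasure (2 ^ k) := fun k => by
    have e1 : ENNReal.ofReal (((2 : ℝ) ^ k) ^ (1 / 2 : ℝ)) ≤
        ENNReal.ofReal (((2 : ℝ) ^ k) ^ (2 * σ)) :=
      ENNReal.ofReal_le_ofReal (Real.rpow_le_rpow_of_exponent_le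
        (one_le_pow₀ (by norm_num)) (by linarith))
    have e2 : ∫⁻ η, ‖g k η‖ₑ ^ 2 ∂annulusMeasure (2 ^ k) ≤ ENNReal.ofReal ((2 ^ j) ^ 2) *
        ∫⁻ η, ‖F η‖ₑ ^ 2 ∂annulusMeasure (2 ^ k) := by
      rw [← lintegral_const_mul' _ _ ENNReal.ofReal_ne_top]
      refine lintegral_mono_ae ((hgle k).mono fun η hη => ?_)
      rw [← ofReal_norm, ← ofReal_norm, ← ENNReal.ofReal_pow (norm_nonneg _),
        ← ENNReal.ofReal_pow (norm_nonneg _), ← ENNReal.ofReal_mul (by positivity), ← mul_pow]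
      exact ENNReal.ofReal_le_ofReal (pow_le_pow_left₀ (norm_nonneg _) hη 2)
    calc _ ≤ C * ENNReal.ofReal (((2 : ℝ) ^ k) ^ (2 * σ)) * (ENNReal.ofReal ((2 ^ j) ^ 2) *
        ∫⁻ η, ‖F η‖ₑ ^ 2 ∂annulusMeasure (2 ^ k)) := by gcongr
      _ = _ := by ring
  refine ae_mem_ball_of_ae_ballMeasure ?_
  filter_upwards [ae_exists_forall_le_of_lintegral_le hS hβ hF (fun k => (hmax' k).1)
    (ENNReal.mul_ne_top hC ENNReal.ofReal_ne_top)
    (fun k => (hmax' k).2.trans (hle k))] with x ⟨D, hD, hx⟩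
  refine ⟨√D, Real.sqrt_nonneg _, fun k z hz t ht => ?_⟩
  have h2 : (0 : ℝ) < 2 ^ k := by positivity
  rw [← integral_cutExp_two_mul_annulusMeasure]
  exact norm_le_of_iSup_enorm_sq_le hD h2 (hx k) (⟨z, hz⟩, ⟨t, ht⟩)

/-- Trade t^(a−h) for N^(−m(a−h)); since b ≤ ma, what remains is at most N^(hm) ≤ N^δ. The cases
needed are N t^α, from the spatial displacement, and N² t, from the time displacement. -/
theorem rpow_mul_rpow_le_of_le_rpow_neg {N t a b h m δ : ℝ} (hN : 1 ≤ N) (ht : 0 < t)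
    (htN : t ≤ N ^ (-m)) (hha : h ≤ a) (hb : b ≤ m * a) (hm : h * m ≤ δ) :
    N ^ b * t ^ a ≤ N ^ δ * t ^ h := by
  have hN0 : 0 < N := by linarith
  calc N ^ b * t ^ a = N ^ b * t ^ (a - h) * t ^ h := by
        rw [mul_assoc, ← Real.rpow_add ht]; congr 2; ring
    _ ≤ N ^ b * (N ^ (-m)) ^ (a - h) * t ^ h := by
        gcongr
    _ = N ^ (b + -m * (a - h)) * t ^ h := by
        rw [← Real.rpow_mul hN0.le, ← Real.rpow_add hN0]
    _ ≤ N ^ δ * t ^ h := by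
        gcongr
        linarith

/-- The convergence theorem in unified form: `m` is the exponent for which frequencies `N` evolve
trivially up to time `N ^ (-m)`. -/
theorem convergesAtRate_of_memSobolev {α x₀ r t₀ T s δ h m : ℝ} {γ : ℝ → ℝ → ℝ} (hα : 0 < α)
    (hα1 : α < 1) (h0 : (0 : ℝ) ∈ Ico (t₀ - T) (t₀ + T))
    (hγ : IsBilipHolderCurve α x₀ r t₀ T γ) (hs : max (1 / 2 - α) (1 / 4) < s) (hδ : 0 ≤ δ)
    (hh : 0 ≤ h) (hhα : h < α) (hm2 : 2 ≤ m) (hmα : 1 ≤ m * α) (hmh : h * m ≤ δ)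
    (f : Lp ℂ 2 (volume : Measure ℝ))
    (hf : TemperedDistribution.MemSobolev (s + δ) 2 (f : 𝓢'(ℝ, ℂ))) :
    ConvergesAtRate f γ x₀ r h := by
  -- The gap s − σ is the ε that makes the block series summable; σ < 1/2 keeps the interpolation
  -- exponent 1 − 2σ positive.
  obtain ⟨σ, hσ1, hσ2⟩ : ∃ σ, max (1 / 2 - α) (1 / 4) < σ ∧ σ < min s (1 / 2) :=
    exists_between (lt_min hs (max_lt (by linarith) (by norm_num)))
  have hσa := (le_max_left _ _).trans_lt hσ1
  have hσb := (le_max_right _ _).trans_lt hσ1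
  have hσs := hσ2.trans_le (min_le_left _ _)
  have hσh := hσ2.trans_le (min_le_right _ _)
  set ε := s - σ with hε
  have hε0 : 0 < ε := sub_pos.2 hσs
  set β := δ + ε with hβ
  have hσβ : σ + β = s + δ := by rw [hβ, hε]; ring
  have hS : 0 ≤ s + δ := by linarith
  have hF := memLp_rpow_mul_fourier_of_memSobolev hf
  have hF2 := Lp.memLp (𝓕 f : Lp ℂ 2 (volume : Measure ℝ))
  set F : Lp ℂ 2 (volume : Measure ℝ) := 𝓕 f with hFdef
  obtain ⟨C, hC⟩ := hγ.holder
  have hT' : 0 < t₀ + T := h0.2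
  have h0I : (0 : ℝ) ∈ Icc (t₀ - T) (t₀ + T) := ⟨h0.1, h0.2.le⟩
  have hdisp : ∀ x ∈ Metric.ball x₀ r, ∀ t ∈ Icc 0 (t₀ + T), |γ x t - x| ≤ |C| * t ^ α := by
    intro x hx t ht
    have h1 := hC x hx t ⟨h0.1.trans ht.1, ht.2⟩ 0 h0I
    rw [hγ.initial x hx, sub_zero, abs_of_nonneg ht.1] at h1
    exact h1.trans (mul_le_mul_of_nonneg_right (le_abs_self C) (Real.rpow_nonneg ht.1 _))
  obtain ⟨ns, hns, hseq⟩ := exists_seq_schrodingerTrunc_zero_tendsto_ae f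
  filter_upwards [hseq, ae_curve_bound hα h0 hγ hσb hσh hσa hS hσβ hF,
    ae_perturbation_bound x₀ r hT'.le (abs_nonneg C) hσb hS hσβ 1 hF2 hF,
    ae_perturbation_bound x₀ r hT'.le (abs_nonneg C) hσb hS hσβ 2 hF2 hF]
    with x hxseq hA hB1 hB2 hx
  obtain ⟨D₀, hD₀, hA⟩ := hA hx
  obtain ⟨D₁, hD₁, hB1⟩ := hB1 hx
  obtain ⟨D₂, hD₂, hB2⟩ := hB2 hx
  have hγ0 : γ x 0 = x := hγ.initial x hx
  set E := (2 * Real.pi * |C| + 4 * Real.pi ^ 2) * (D₁ + D₂) with hE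
  have hE0 : 0 ≤ E := by positivity
  have hsmall : ∀ (k : ℕ), ∀ t ∈ Ioc 0 (t₀ + T), t ≤ (2 ^ k : ℝ) ^ (-m) →
      ‖(schrodingerTrunc f t (γ x t) (2 * 2 ^ k) - schrodingerTrunc f t (γ x t) (2 ^ k)) -
        (schrodingerTrunc f 0 (γ x 0) (2 * 2 ^ k) - schrodingerTrunc f 0 (γ x 0) (2 ^ k))‖ ≤
        (D₀ + E) * (2 ^ k : ℝ) ^ (-ε) * t ^ h := by
    intro k t ht htk
    set N : ℝ := 2 ^ k with hN
    have hN1 : 1 ≤ N := one_le_pow₀ (by norm_num)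
    have hN0 : 0 < N := by linarith
    set z := γ x t - x with hz
    have ht' : t ∈ Icc 0 (t₀ + T) := ⟨ht.1.le, ht.2⟩
    have hzt : |z| ≤ |C| * t ^ α := hdisp x hx t ht'
    -- Since mα ≥ 1, the curve stays within the range of the perturbation maximal function up to
    -- time N^(-m).
    have hzN : |z| ≤ |C| / N := by
      refine hzt.trans ?_
      rw [div_eq_mul_inv, ← Real.rpow_neg_one]
      gcongr
      calc t ^ α ≤ (N ^ (-m)) ^ α := Real.rpow_le_rpow ht.1.le htk hα.le
        _ = N ^ (-(m * α)) := by rw [← Real.rpow_mul hN0.le]; congr 1; ring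
        _ ≤ N ^ (-1 : ℝ) := Real.rpow_le_rpow_of_exponent_le hN1 (by linarith)
    have hscale : ∀ u ∈ Icc (0 : ℝ) 1, u * z ∈ Icc (-(|C| / N)) (|C| / N) ∧
        u * t ∈ Icc 0 (t₀ + T) := fun u hu => by
      refine ⟨abs_le.1 ?_, mul_nonneg hu.1 ht.1.le,
        (mul_le_of_le_one_left ht.1.le hu.2).trans ht.2⟩
      rw [abs_mul, abs_of_nonneg hu.1]
      exact (mul_le_of_le_one_left (abs_nonneg _) hu.2).trans hzN
    have hNβ : 0 ≤ N ^ (-β) := by positivity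
    have hmv := norm_integral_quadExp_sub_le (F := F) hN0
      (MemLp.integrable (by norm_num : (1 : ℝ≥0∞) ≤ 2) (hF2.restrict _)) (x := x) (z := z) (t := t)
      (M := (D₁ + D₂) * N ^ (-β))
      (fun u hu => by
        have := hB1 k _ (hscale u hu).1 _ (hscale u hu).2
        simp only [pow_one] at this
        exact this.trans (by gcongr; linarith))
      (fun u hu => (hB2 k _ (hscale u hu).1 _ (hscale u hu).2).trans (by gcongr; linarith))
    have hd1 : schrodingerTrunc f t (γ x t) (2 * N) - schrodingerTrunc f t (γ x t) N =
        ∫ η, quadExp (2 * Real.pi * (x + z)) (4 * Real.pi ^ 2 * t) η * F η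
          ∂annulusMeasure N := by
      rw [schrodingerTrunc_sub f t _ hN0.le (by linarith) le_rfl,
        integral_cutExp_two_mul_annulusMeasure, hz, add_sub_cancel]
    have hd2 : schrodingerTrunc f 0 (γ x 0) (2 * N) - schrodingerTrunc f 0 (γ x 0) N =
        ∫ η, quadExp (2 * Real.pi * x) 0 η * F η ∂annulusMeasure N := by
      rw [schrodingerTrunc_sub f 0 _ hN0.le (by linarith) le_rfl,
        integral_cutExp_two_mul_annulusMeasure, hγ0, mul_zero]
    rw [hd1, hd2]
    refine hmv.trans ?_
    have g1 : N * |z| ≤ |C| * (N ^ δ * t ^ h) := by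
      have := rpow_mul_rpow_le_of_le_rpow_neg hN1 ht.1 htk hhα.le hmα hmh
      rw [Real.rpow_one] at this
      calc N * |z| ≤ N * (|C| * t ^ α) := by gcongr
        _ = |C| * (N * t ^ α) := by ring
        _ ≤ _ := by gcongr
    have g2 : N ^ 2 * |t| ≤ N ^ δ * t ^ h := by
      have := rpow_mul_rpow_le_of_le_rpow_neg (b := 2) (a := 1) hN1 ht.1 htk (by linarith)
        (by linarith) hmh
      rw [abs_of_pos ht.1]
      rwa [Real.rpow_one, Real.rpow_two] at this
    have g3 : N ^ (-β) = N ^ (-δ) * N ^ (-ε) := by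
      rw [← Real.rpow_add hN0, hβ]; congr 1; ring
    have g4 : N ^ δ * N ^ (-δ) = 1 := by rw [← Real.rpow_add hN0]; simp
    have hth : 0 ≤ t ^ h := Real.rpow_nonneg ht.1.le _
    calc (2 * Real.pi * N * |z| + 4 * Real.pi ^ 2 * N ^ 2 * |t|) * ((D₁ + D₂) * N ^ (-β))
        = (2 * Real.pi * (N * |z|) + 4 * Real.pi ^ 2 * (N ^ 2 * |t|)) *
            ((D₁ + D₂) * N ^ (-β)) := by ring
      _ ≤ (2 * Real.pi * (|C| * (N ^ δ * t ^ h)) + 4 * Real.pi ^ 2 * (N ^ δ * t ^ h)) *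
            ((D₁ + D₂) * N ^ (-β)) := by gcongr
      _ = E * N ^ (-ε) * t ^ h * (N ^ δ * N ^ (-δ)) := by rw [g3, hE]; ring
      _ = E * N ^ (-ε) * t ^ h := by rw [g4, mul_one]
      _ ≤ (D₀ + E) * N ^ (-ε) * t ^ h := by gcongr; linarith
  have hfixed : ∀ R : ℝ, 0 ≤ R → ∃ B : ℝ, 0 ≤ B ∧ ∀ t ∈ Icc 0 (t₀ + T),
      ‖schrodingerTrunc f t (γ x t) R - schrodingerTrunc f 0 (γ x 0) R‖ ≤ B * (t ^ α + t) := by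
    intro R hR
    obtain ⟨B, hB0, hB⟩ := exists_norm_schrodingerTrunc_sub_le f hR
    refine ⟨B * (|C| + 1), by positivity, fun t ht => ?_⟩
    have h1 := hB t x (γ x t)
    simp only [hγ0]
    refine h1.trans ?_
    rw [mul_assoc, abs_of_nonneg ht.1]
    have h2 := hdisp x hx t ht
    have h3 : 0 ≤ t ^ α := Real.rpow_nonneg ht.1 _
    have h4 : 0 ≤ |C| * t := mul_nonneg (abs_nonneg _) ht.1
    gcongr
    nlinarith
  obtain ⟨L, hL, hLo⟩ := exists_tendsto_and_isLittleO_of_dyadic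
    (S := fun t R => schrodingerTrunc f t (γ x t) R) (D := D₀ + E) (β := β) (δ := δ) (ε := ε)
    (h := h) (α := α) (m := m) (T := t₀ + T) hT' (by positivity) hε0 hδ hβ hh hhα hα1 hmh
    (fun k t ht R hR => (hA k t ht R hR).trans (by gcongr; linarith)) hsmall hfixed
  -- The dyadic bounds include t = 0, so the full limit exists there and must agree with the
  -- subsequential one.
  have hLf : L 0 = f x := by
    have h1 := hL 0 (left_mem_Icc.2 hT'.le)
    simp only [hγ0] at h1
    have h2 : Tendsto (fun i => (2 : ℝ) ^ ns i) atTop atTop :=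
      (tendsto_pow_atTop_atTop_of_one_lt (by norm_num)).comp hns.tendsto_atTop
    exact tendsto_nhds_unique (h1.comp h2) hxseq
  have hnear : ∀ᶠ t in 𝓝[>] (0 : ℝ), t ∈ Icc 0 (t₀ + T) :=
    mem_of_superset (Ioc_mem_nhdsGT hT') Ioc_subset_Icc_self
  refine ⟨hnear.mono fun t ht => ⟨L t, hL t ht⟩, hLo.congr' ?_ EventuallyEq.rfl⟩
  filter_upwards [hnear] with t ht
  rw [hLf, schrodinger, (hL t ht).limUnder_eq]

end Assembly

/-- The two cases are m = 2 and m = 1/α: the smallest m with m ≥ 2 and mα ≥ 1 is max(2, 1/α), and hm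
≤ δ then becomes h ≤ δ/2 or h ≤ αδ. -/
theorem mainTheorem12 (α x₀ r t₀ T : ℝ) (γ : ℝ → ℝ → ℝ) (hr : 0 < r) (hT : 0 < T)
    (h0 : (0 : ℝ) ∈ Set.Ico (t₀ - T) (t₀ + T))
    (hγ : IsBilipHolderCurve α x₀ r t₀ T γ) :
    (1 / 2 ≤ α → α < 1 → ∀ s : ℝ, 1 / 4 < s → ∀ δ h : ℝ, 0 ≤ δ → 0 ≤ h → h ≤ δ / 2 → h < α →
      ∀ f : MeasureTheory.Lp ℂ 2 (MeasureTheory.volume : MeasureTheory.Measure ℝ),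
        TemperedDistribution.MemSobolev (s + δ) 2 (f : 𝓢'(ℝ, ℂ)) →
          ConvergesAtRate f γ x₀ r h) ∧
    (0 < α → α < 1 / 2 → ∀ s : ℝ, max (1 / 2 - α) (1 / 4) < s →
      ∀ δ h : ℝ, 0 ≤ δ → 0 ≤ h → h ≤ α * δ → h < α →
      ∀ f : MeasureTheory.Lp ℂ 2 (MeasureTheory.volume : MeasureTheory.Measure ℝ),
        TemperedDistribution.MemSobolev (s + δ) 2 (f : 𝓢'(ℝ, ℂ)) →
          ConvergesAtRate f γ x₀ r h) := by
  refine ⟨fun hα hα1 s hs δ h hδ hh hhδ hhα f hf => ?_,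
    fun hα hα2 s hs δ h hδ hh hhδ hhα f hf => ?_⟩
  · exact convergesAtRate_of_memSobolev (m := 2) (by linarith) hα1 h0 hγ
      (max_lt (by linarith) hs) hδ hh hhα le_rfl (by linarith) (by linarith) f hf
  · refine convergesAtRate_of_memSobolev (m := 1 / α) hα (by linarith) h0 hγ hs hδ hh hhα
      ?_ ?_ ?_ f hf
    · rw [le_div_iff₀ hα]; linarith
    · rw [one_div, inv_mul_cancel₀ hα.ne']
    · rw [mul_one_div, div_le_iff₀ hα]; linarith
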